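/- Let $q$ be a prime power and let $V$ be a vector space of dimension $v$ over the field with $q$ elements. For integers $0\le t\le k\le v$, a set $\mathcal B$ of $k$-dimensional subspaces of $V$ is called a $t$-$(v,k,\lambda)_q$ subspace design if every $t$-dimensional subspace of $V$ is contained in exactly $\lambda$ elements of $\mathcal B$. A large set $\mathrm{LS}_q[N](t,k,v)$ is a partition of the set of all $k$-dimensional subspaces of $V$ into $N$ (nonempty) parts, each of which is a $t$-$(v,k,\lambda)_q$ subspace design, with the same $\lambda$ for all parts; it is called nontrivial if $N\ge 2$. There are infinitely many nontrivial large sets of subspace designs with $t=2$; that is, there are infinitely many quadruples $(q,N,k,v)$ with $q$ a prime power, $N\ge 2$ and $2\le k\le v$ for which a large set $\mathrm{LS}_q[N](2,k,v)$ exists. -/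

import Mathlib

/-- The Grassmannian: the set of all `k`-dimensional subspaces of `V`. -/
def grassmannian (F V : Type) [Field F] [AddCommGroup V] [Module F V] (k : ℕ) :
    Set (Submodule F V) :=
  {U | Module.finrank F U = k}

/-- `B` is (the block set of) a `t`-`(v, k, l)_q` subspace design on `V`, where `q = |F|` and
`v = dim V`: a set of `k`-subspaces such that each `t`-subspace of `V` is contained in exactly
`l` of them. -/
def IsSubspaceDesign (F V : Type) [Field F] [AddCommGroup V] [Module F V] (t k l : ℕ)
    (B : Set (Submodule F V)) : Prop :=
  B ⊆ grassmannian F V k ∧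
    ∀ T ∈ grassmannian F V t, {K ∈ B | T ≤ K}.encard = l

/-- `L` is (the set of block sets of) a large set `LS_q[N](t, k, v)` on `V`, where `q = |F|` and
`v = dim V`: a partition of the Grassmannian of `k`-subspaces of `V` into `N` nonempty, pairwise
disjoint parts, which are `t`-`(v, k, l)_q` subspace designs for a common value of `l`. -/
structure IsLargeSet (F V : Type) [Field F] [AddCommGroup V] [Module F V] (N t k : ℕ)
    (L : Set (Set (Submodule F V))) : Prop where
  nonempty_of_mem : ∀ B ∈ L, B.Nonempty
  pairwise_disjoint : ∀ B ∈ L, ∀ B' ∈ L, B ≠ B' → Disjoint B B'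
  sUnion_eq : ⋃₀ L = grassmannian F V k
  encard_eq : L.encard = N
  exists_design : ∃ l : ℕ, ∀ B ∈ L, IsSubspaceDesign F V t k l B

/-- The parameter set `LS_q[N](t, k, v)` is realizable: there is a large set with these parameters
on a `v`-dimensional vector space over a field with `q` elements. -/
def LargeSetRealizable (q N t k v : ℕ) : Prop :=
  ∃ (F : Type) (_ : Field F) (_ : Finite F) (V : Type) (_ : AddCommGroup V) (_ : Module F V)
    (_ : FiniteDimensional F V) (L : Set (Set (Submodule F V))),
    Nat.card F = q ∧ Module.finrank F V = v ∧ IsLargeSet F V N t k L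

open Module Submodule
set_option linter.unusedSectionVars false

/-! ### Sums over fibres of surjections -/

section SumLemmas

/-! The designs have block dimension 3 over the field with three elements, and `N = 2`: a large set
is then a ±1-colouring of the 3-spaces in which the colours cancel over the 3-spaces through any
given plane. `IsHalving` expresses this by a sum over vectors `c ∉ T` instead of over covers of `T`;
each cover is hit equally often, and linear maps act well on such sums because their fibres have
equal size.

Recursion (`HasHalvings.extend`): in dimension `w + 6` fix a chain `W₁ < W₂ < W₃` of dimensions `w,
w + 1, w + 2`. Every 3-space has exactly one `j` for which it looks like a `j`-space in `W_j` joined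
to a `(3 - j)`-space of `V ⧸ W_(j+1)` (all in `W₃` for `j = 3`, all in `V ⧸ W₁` for `j = 0`). Colour
it by the product of the signs of the two pieces, obtained from dimensions `w + 2` and `6` by
passing to derived halvings. For a fixed plane the extending vectors split into two ranges; in each,
one piece is frozen and the other runs through a halving, so both partial sums vanish. Thus
dimension 6 yields all dimensions `4m + 6`.

Base case (`GF729.hasHalvings`): identify the 6-space with the field of 729 elements. A 3-space is
coloured through two Moore determinants of a basis. A change of basis multiplies both by the same
±1, which leaves the sign alone; multiplication by the generator of the field reverses all signs.
Hence only planes containing 1 matter. For the plane spanned by `1, b` the determinants are linear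
in the third vector and vanish on the plane, so 729 terms reduce to 81; normalising `b` leaves 121
sums, evaluated by the kernel. -/

theorem finsum_comp_surjective_addHom {A B : Type} [AddCommGroup A] [AddCommGroup B] [Finite A]
    (p : A →+ B) (hp : Function.Surjective p) (G : B → ℤ) :
    ∑ᶠ a, G (p a) = (Nat.card p.ker : ℤ) * ∑ᶠ b, G b := by
  classical
  have : Finite B := Finite.of_surjective p hp
  have := Fintype.ofFinite A
  have := Fintype.ofFinite B
  rw [finsum_eq_sum_of_fintype, finsum_eq_sum_of_fintype, Finset.mul_sum,
    ← Finset.sum_fiberwise (s := Finset.univ) (g := p)]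
  refine Finset.sum_congr rfl fun b _ => ?_
  rw [Finset.sum_congr rfl (g := fun _ => G b) (fun a ha => by rw [(Finset.mem_filter.1 ha).2]),
    Finset.sum_const, nsmul_eq_mul]
  congr 2
  obtain ⟨a₀, rfl⟩ := hp b
  rw [← Fintype.card_subtype, Nat.card_eq_fintype_card]
  refine Fintype.card_congr ⟨fun a => ⟨a - a₀, by simp [AddMonoidHom.mem_ker, a.2]⟩,
    fun k => ⟨k + a₀, by simp [(AddMonoidHom.mem_ker).1 k.2]⟩, fun a => by simp, fun k => by simp⟩

end SumLemmas

/-! ### Halvings of quotients, subspaces and derived halvings -/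

/-- A two-colouring (by signs) of the subspaces of `V` such that for every `t`-subspace `T`
the signs of the spans of `T` and one further vector cancel. -/
structure IsHalving (K : Type) {V : Type} [Field K] [AddCommGroup V] [Module K V] (t : ℕ)
    (f : Submodule K V → ℤ) : Prop where
  sign : ∀ U, f U = 1 ∨ f U = -1
  sum_eq_zero : ∀ T : Submodule K V, finrank K T = t →
    ∑ᶠ c : V, (open Classical in if c ∈ T then 0 else f (T ⊔ span K {c})) = 0

/-- Every `n`-dimensional space over `K` has a halving for `t`-subspaces. -/
def HasHalvings (K : Type) [Field K] (t n : ℕ) : Prop :=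
  ∀ (V : Type) [AddCommGroup V] [Module K V] [FiniteDimensional K V], finrank K V = n →
    ∃ f : Submodule K V → ℤ, IsHalving K t f

section

variable {K V : Type} [Field K] [Finite K] [AddCommGroup V] [Module K V] [FiniteDimensional K V]

/-- The summand depends only on `c` modulo `W`, and `c ∈ W ⊔ T` means that its class lies in the
image of `T`. So the sum is a multiple of the cancelling sum for `f` at that image. -/
theorem finsum_quotient_eq_zero (W T : Submodule K V) {t : ℕ} {f : Submodule K (V ⧸ W) → ℤ}
    (hf : IsHalving K t f) (hT : finrank K (T.map W.mkQ) = t) (s : ℤ) :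
    ∑ᶠ c : V, (open Classical in if c ∈ W ⊔ T then 0
      else s * f ((T ⊔ span K {c}).map W.mkQ)) = 0 := by
  classical
  have : Finite V := Module.finite_of_finite K
  have h := finsum_comp_surjective_addHom W.mkQ.toAddMonoidHom W.mkQ_surjective
    (fun d => s * if d ∈ T.map W.mkQ then 0 else f (T.map W.mkQ ⊔ span K {d}))
  have : Finite (V ⧸ W) := Module.finite_of_finite K
  have h0 := mul_finsum (fun d => if d ∈ T.map W.mkQ then 0 else
    f (T.map W.mkQ ⊔ span K {d})) s
  rw [hf.sum_eq_zero _ hT, mul_zero] at h0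
  rw [← h0, mul_zero] at h
  refine Eq.trans (finsum_congr fun c => ?_) h
  have hc : c ∈ W ⊔ T ↔ W.mkQ c ∈ T.map W.mkQ := by
    rw [← mem_comap, comap_map_mkQ]
  rw [LinearMap.toAddMonoidHom_coe, Submodule.map_sup, map_span, Set.image_singleton]
  by_cases hm : W.mkQ c ∈ T.map W.mkQ
  · rw [if_pos hm, if_pos (hc.2 hm), mul_zero]
  · rw [if_neg hm, if_neg fun h => hm (hc.1 h)]

theorem comap_subtype_sup_span (W T : Submodule K V) (w : W) :
    (T ⊔ span K {(w : V)}).comap W.subtype = T.comap W.subtype ⊔ span K {w} := by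
  refine le_antisymm ?_ ?_
  · intro x hx
    obtain ⟨y, hy, z, hz, h⟩ := mem_sup.1 (mem_comap.1 hx)
    obtain ⟨r, rfl⟩ := mem_span_singleton.1 hz
    refine mem_sup.2 ⟨x - r • w, ?_, r • w, mem_span_singleton.2 ⟨r, rfl⟩, by simp⟩
    have hxy : (x : V) - r • (w : V) = y := by
      rw [sub_eq_iff_eq_add, h]; rfl
    rw [mem_comap]
    simpa [hxy] using hy
  · refine sup_le (comap_mono le_sup_left) ?_
    rw [span_singleton_le_iff_mem, mem_comap]
    exact mem_sup_right (mem_span_singleton_self _)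

theorem sup_span_add_eq (T : Submodule K V) {t : V} (ht : t ∈ T) (w : V) :
    T ⊔ span K {w + t} = T ⊔ span K {w} := by
  refine le_antisymm (sup_le le_sup_left ?_) (sup_le le_sup_left ?_)
  · rw [span_singleton_le_iff_mem]
    exact add_mem (mem_sup_right (mem_span_singleton_self _)) (mem_sup_left ht)
  · rw [span_singleton_le_iff_mem]
    have : w = (w + t) - t := by abel
    rw [this]
    refine sub_mem (mem_sup_right ?_) (mem_sup_left ht)
    rw [← this]
    exact mem_span_singleton_self _

/-- Addition `W × T → W ⊔ T` has fibres of equal size, and `T ⊔ ⟨w + t⟩ = T ⊔ ⟨w⟩`. After pulling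
back, the sum is a multiple of the cancelling sum for `f` at `W ⊓ T`, by the modular law. -/
theorem finsum_sub_eq_zero (W T : Submodule K V) {t : ℕ} {f : Submodule K W → ℤ}
    (hf : IsHalving K t f) (hT : finrank K (T.comap W.subtype) = t) (s : ℤ) :
    ∑ᶠ c : V, (open Classical in if c ∈ W ⊔ T ∧ c ∉ T then
      s * f ((T ⊔ span K {c}).comap W.subtype) else 0) = 0 := by
  classical
  have : Finite V := Module.finite_of_finite K
  let G : V → ℤ := fun c => if c ∈ T then 0 else s * f ((T ⊔ span K {c}).comap W.subtype)
  have h1 : ∑ᶠ c : V, (if c ∈ W ⊔ T ∧ c ∉ T then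
      s * f ((T ⊔ span K {c}).comap W.subtype) else 0) = ∑ᶠ c : ↥(W ⊔ T), G c := by
    have := finsum_set_coe_eq_finsum_mem (f := G) ((W ⊔ T : Submodule K V) : Set V)
    rw [finsum_mem_def] at this
    refine Eq.trans (finsum_congr fun c => ?_) this.symm
    by_cases h1 : c ∈ W ⊔ T <;> by_cases h2 : c ∈ T <;>
      simp [Set.indicator, h1, h2, G]
  rw [h1]
  let p : W × T →+ ↥(W ⊔ T) := ((Submodule.inclusion (le_sup_left : W ≤ W ⊔ T)).coprod
    (Submodule.inclusion (le_sup_right : T ≤ W ⊔ T))).toAddMonoidHom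
  have hp : Function.Surjective p := by
    rintro ⟨x, hx⟩
    obtain ⟨y, hy, z, hz, h⟩ := mem_sup.1 hx
    exact ⟨(⟨y, hy⟩, ⟨z, hz⟩), Subtype.ext h⟩
  have h2 := finsum_comp_surjective_addHom p hp (fun c => G c)
  have h3 : ∑ᶠ x : W × T, G (p x) = 0 := by
    have e : ∀ x : W × T, G (p x) = s * (if x.1 ∈ T.comap W.subtype then 0 else
        f (T.comap W.subtype ⊔ span K {x.1})) := by
      rintro ⟨w, t⟩
      have hpx : ((p (w, t) : ↥(W ⊔ T)) : V) = (w : V) + t := rfl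
      have hm : ((w : V) + t ∈ T) ↔ (w : V) ∈ T := T.add_mem_iff_left t.2
      simp only [G, hpx, hm, sup_span_add_eq T t.2, comap_subtype_sup_span, mem_comap, subtype_apply]
      split_ifs <;> simp
    have := Fintype.ofFinite W
    have := Fintype.ofFinite T
    have h4 := hf.sum_eq_zero _ hT
    rw [finsum_eq_sum_of_fintype] at h4
    rw [finsum_congr e, finsum_eq_sum_of_fintype, Fintype.sum_prod_type_right]
    simp only [← Finset.mul_sum, h4, mul_zero, Finset.sum_const_zero]
  rw [h3] at h2
  have : (Nat.card p.ker : ℤ) ≠ 0 := by exact_mod_cast Nat.card_pos.ne'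
  exact (mul_eq_zero.1 h2.symm).resolve_left this

/-- Colour a subspace of `V` by its preimage in `V × K`: preimages raise dimensions by one and
commute with adjoining a vector. -/
theorem HasHalvings.derived {t n : ℕ} (h : HasHalvings K (t + 1) (n + 1)) : HasHalvings K t n := by
  classical
  intro V _ _ _ hV
  have : Finite V := Module.finite_of_finite K
  obtain ⟨f, hf⟩ := h (V × K) (by simp [hV])
  refine ⟨fun U => f (U.comap (LinearMap.fst K V K)), fun U => hf.sign _, fun T hT => ?_⟩
  set p := LinearMap.fst K V K with hp
  have hps : Function.Surjective p := LinearMap.fst_surjective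
  have hdim : finrank K (T.comap p) = t + 1 := by
    have hr : T.comap p = LinearMap.range (T.subtype.prodMap (LinearMap.id : K →ₗ[K] K)) := by
      ext x
      simp [hp]
    rw [hr, LinearMap.finrank_range_of_inj
      (Prod.map_injective.2 ⟨T.injective_subtype, fun _ _ h => h⟩)]
    simp [hT]
  have h2 := hf.sum_eq_zero (T.comap p) hdim
  have h3 := finsum_comp_surjective_addHom p.toAddMonoidHom hps (fun c => if c ∈ T then 0 else
      f ((T ⊔ span K {c}).comap p))
  have h4 : ∀ c : V × K, (T ⊔ span K {p c}).comap p = T.comap p ⊔ span K {c} := by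
    intro c
    have hker : LinearMap.ker p ≤ T.comap p ⊔ span K {c} :=
      le_trans (LinearMap.ker_le_comap p) le_sup_left
    rw [← comap_map_eq_self hker, Submodule.map_sup, map_comap_eq_of_surjective hps, map_span,
      Set.image_singleton]
  simp only [LinearMap.toAddMonoidHom_coe, h4] at h3
  simp only [mem_comap] at h2
  rw [h2] at h3
  have : (Nat.card p.toAddMonoidHom.ker : ℤ) ≠ 0 := by exact_mod_cast Nat.card_pos.ne'
  exact (mul_eq_zero.1 h3.symm).resolve_left this

end

/-! ### The recursive construction -/

section

variable {K V : Type} [Field K] [Finite K] [AddCommGroup V] [Module K V] [FiniteDimensional K V]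

/-- The two vanishing sums cover complementary ranges of `c`. `W` and `W'` may differ, provided they
have the same join with `T`; this is where the classes of the colouring meet. -/
theorem sum_eq_zero_of_split (F : Submodule K V → ℤ) (T W W' : Submodule K V) {t t' : ℕ}
    {f : Submodule K W → ℤ} {f' : Submodule K (V ⧸ W') → ℤ} (s s' : ℤ)
    (hW : W ⊔ T = W' ⊔ T) (hf : IsHalving K t f) (hf' : IsHalving K t' f')
    (ht : finrank K (T.comap W.subtype) = t) (ht' : finrank K (T.map W'.mkQ) = t')
    (h : ∀ c ∈ W ⊔ T, c ∉ T → F (T ⊔ span K {c}) = s * f ((T ⊔ span K {c}).comap W.subtype))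
    (h' : ∀ c ∉ W' ⊔ T, F (T ⊔ span K {c}) = s' * f' ((T ⊔ span K {c}).map W'.mkQ)) :
    ∑ᶠ c : V, (open Classical in if c ∈ T then 0 else F (T ⊔ span K {c})) = 0 := by
  classical
  have : Finite V := Module.finite_of_finite K
  have h1 := finsum_sub_eq_zero W T hf ht s
  have h2 := finsum_quotient_eq_zero W' T hf' ht' s'
  have h3 := finsum_add_distrib (f := fun c : V => if c ∈ W ⊔ T ∧ c ∉ T then
      s * f ((T ⊔ span K {c}).comap W.subtype) else 0) (g := fun c : V => if c ∈ W' ⊔ T then 0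
      else s' * f' ((T ⊔ span K {c}).map W'.mkQ)) (Set.toFinite _) (Set.toFinite _)
  rw [h1, h2, add_zero] at h3
  refine Eq.trans (finsum_congr fun c => ?_) h3
  by_cases hc : c ∈ T
  · simp [hc, (le_sup_right : T ≤ W' ⊔ T) hc]
  · by_cases hc' : c ∈ W ⊔ T
    · simp [hc, hc', ← hW, h c hc' hc]
    · simp [hc, hc', ← hW, h' c (hW ▸ hc')]

theorem finrank_comap_subtype (W T : Submodule K V) :
    finrank K (T.comap W.subtype) = finrank K ↥(W ⊓ T) := by
  rw [← finrank_map_subtype_eq, map_comap_subtype]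

theorem finrank_sup_add_finrank_comap (W T : Submodule K V) :
    finrank K ↥(W ⊔ T) + finrank K (T.comap W.subtype) = finrank K W + finrank K T := by
  rw [finrank_comap_subtype, finrank_sup_add_finrank_inf_eq]

theorem finrank_map_mkQ_add_finrank_comap (W T : Submodule K V) :
    finrank K (T.map W.mkQ) + finrank K (T.comap W.subtype) = finrank K T := by
  have h := (W.mkQ.domRestrict T).finrank_range_add_finrank_ker
  rw [LinearMap.range_domRestrict] at h
  have hk : LinearMap.ker (W.mkQ.domRestrict T) = W.comap T.subtype := by
    ext x
    simp
  rwa [hk, finrank_comap_subtype, inf_comm, ← finrank_comap_subtype] at h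

/-- A vector of `W` involving `c` with nonzero coefficient would put `c` into `W ⊔ T`. This and the
next lemma freeze one of the two factors of a product colour. -/
theorem comap_sup_span_eq_of_notMem {W T : Submodule K V} {c : V} (hc : c ∉ W ⊔ T) :
    (T ⊔ span K {c}).comap W.subtype = T.comap W.subtype := by
  refine le_antisymm (fun x hx => ?_) (comap_mono le_sup_left)
  obtain ⟨y, hy, z, hz, h⟩ := mem_sup.1 (mem_comap.1 hx)
  obtain ⟨r, rfl⟩ := mem_span_singleton.1 hz
  by_cases hr : r = 0
  · subst hr
    rw [mem_comap, ← h]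
    simpa using hy
  · refine absurd ?_ hc
    have : c = r⁻¹ • ((x : V) - y) := by
      rw [← subtype_apply, ← h, add_sub_cancel_left, smul_smul, inv_mul_cancel₀ hr, one_smul]
    rw [this]
    exact smul_mem _ _ (sub_mem (mem_sup_left x.2) (mem_sup_right hy))

theorem map_mkQ_sup_span_eq_of_mem {W T : Submodule K V} {c : V} (hc : c ∈ W ⊔ T) :
    (T ⊔ span K {c}).map W.mkQ = T.map W.mkQ := by
  refine le_antisymm ?_ (map_mono le_sup_left)
  rw [map_le_iff_le_comap, comap_map_mkQ]
  exact sup_le le_sup_right ((span_singleton_le_iff_mem _ _).2 hc)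

theorem sup_sup_span_eq_of_mem {W T : Submodule K V} {c : V} (hc : c ∈ W ⊔ T) :
    W ⊔ (T ⊔ span K {c}) = W ⊔ T := by
  rw [← sup_assoc]
  exact sup_eq_left.2 ((span_singleton_le_iff_mem _ _).2 hc)

theorem exists_finrank_eq_of_le {n : ℕ} (hn : n ≤ finrank K V) :
    ∃ W : Submodule K V, finrank K W = n := by
  induction n with
  | zero => exact ⟨⊥, finrank_bot K V⟩
  | succ n ih =>
    obtain ⟨W, hW⟩ := ih (by omega)
    obtain ⟨c, hc⟩ : ∃ c, c ∉ W := by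
      by_contra! h
      have : W = ⊤ := eq_top_iff.2 fun x _ => h x
      rw [this, finrank_top] at hW
      omega
    exact ⟨W ⊔ span K {c}, by rw [finrank_sup_span_singleton hc, hW]⟩

theorem exists_le_finrank_eq_succ {W : Submodule K V} (hn : finrank K W < finrank K V) :
    ∃ W' : Submodule K V, W ≤ W' ∧ finrank K W' = finrank K W + 1 := by
  obtain ⟨c, hc⟩ : ∃ c, c ∉ W := by
    by_contra! h
    have : W = ⊤ := eq_top_iff.2 fun x _ => h x
    rw [this, finrank_top] at hn
    omega
  exact ⟨W ⊔ span K {c}, le_sup_left, finrank_sup_span_singleton hc⟩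

/-- Halvings of planes extend from dimension `w + 2` to dimension `w + 6`. -/
theorem HasHalvings.extend {w : ℕ} (h6 : HasHalvings K 2 6) (hw : HasHalvings K 2 (w + 2)) :
    HasHalvings K 2 (w + 6) := by
  classical
  intro V _ _ _ hV
  obtain ⟨W₁, d₁⟩ := exists_finrank_eq_of_le (K := K) (V := V) (n := w) (by omega)
  obtain ⟨W₂, l₁, d₂⟩ := exists_le_finrank_eq_succ (W := W₁) (by omega)
  obtain ⟨W₃, l₂, d₃⟩ := exists_le_finrank_eq_succ (W := W₂) (by omega)
  obtain ⟨a, ha⟩ := hw W₃ (by omega)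
  obtain ⟨b, hb⟩ := hw.derived W₂ (by omega)
  obtain ⟨b', hb'⟩ := h6.derived.derived (V ⧸ W₃) (by rw [finrank_quotient]; omega)
  obtain ⟨e, he⟩ := h6 (V ⧸ W₁) (by rw [finrank_quotient]; omega)
  obtain ⟨p, hp⟩ := hw.derived.derived W₁ (by omega)
  obtain ⟨p', hp'⟩ := h6.derived (V ⧸ W₂) (by rw [finrank_quotient]; omega)
  -- For 3-spaces the branches are the types `j = 3, 2, 0, 1`. In the last one both `U ⊓ W₁` and `U
  -- ⊓ W₂` are lines.
  let F : Submodule K V → ℤ := fun U =>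
    if U ≤ W₃ then a (U.comap W₃.subtype)
    else if finrank K (U.comap W₂.subtype) = 2 then
      b (U.comap W₂.subtype) * b' (U.map W₃.mkQ)
    else if finrank K (U.comap W₁.subtype) = 0 then e (U.map W₁.mkQ)
    else p (U.comap W₁.subtype) * p' (U.map W₂.mkQ)
  refine ⟨F, fun U => ?_, fun T hT => ?_⟩
  · have := ha.sign (U.comap W₃.subtype)
    have := he.sign (U.map W₁.mkQ)
    simp only [F]
    split_ifs
    · assumption
    · rcases hb.sign (U.comap W₂.subtype) with h | h <;>
        rcases hb'.sign (U.map W₃.mkQ) with h' | h' <;> simp [h, h']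
    · assumption
    · rcases hp.sign (U.comap W₁.subtype) with h | h <;>
        rcases hp'.sign (U.map W₂.mkQ) with h' | h' <;> simp [h, h']
  have q₁ := finrank_sup_add_finrank_comap W₁ T
  have q₂ := finrank_sup_add_finrank_comap W₂ T
  have q₃ := finrank_sup_add_finrank_comap W₃ T
  have r₁ := finrank_map_mkQ_add_finrank_comap W₁ T
  have r₂ := finrank_map_mkQ_add_finrank_comap W₂ T
  have r₃ := finrank_map_mkQ_add_finrank_comap W₃ T
  have g₁ : finrank K ↥(W₁ ⊔ T) ≤ finrank K ↥(W₂ ⊔ T) := finrank_mono (sup_le_sup_right l₁ T)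
  have i₁ : finrank K (T.comap W₁.subtype) ≤ finrank K (T.comap W₂.subtype) := by
    rw [finrank_comap_subtype, finrank_comap_subtype]
    exact finrank_mono (inf_le_inf_right T l₁)
  have dim : ∀ c ∉ T, finrank K ↥(T ⊔ span K {c}) = 3 := fun c hc => by
    rw [finrank_sup_span_singleton hc, hT]
  by_cases hT₃ : T ≤ W₃
  · have e₃ : W₃ ⊔ T = W₃ := sup_eq_left.2 hT₃
    have notle : ∀ c ∉ W₃, ¬ T ⊔ span K {c} ≤ W₃ := fun c hc h =>
      hc (h (mem_sup_right (mem_span_singleton_self c)))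
    have key : ∀ c ∈ W₃ ⊔ T, c ∉ T → F (T ⊔ span K {c}) =
        1 * a ((T ⊔ span K {c}).comap W₃.subtype) := fun c hc _ => by
      rw [e₃] at hc
      simp only [F]
      rw [if_pos (sup_le hT₃ ((span_singleton_le_iff_mem _ _).2 hc)), one_mul]
    have n₃ : finrank K (T.comap W₃.subtype) = 2 := by rw [e₃] at q₃; omega
    by_cases hT₂ : T ≤ W₂
    -- Vectors in `W₃` give type 3, all others type 2 with `U ⊓ W₂ = T`.
    · have e₂ : W₂ ⊔ T = W₂ := sup_eq_left.2 hT₂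
      refine sum_eq_zero_of_split F T W₃ W₃ 1 (b (T.comap W₂.subtype)) rfl ha hb' n₃
        (by omega) key fun c hc => ?_
      rw [e₃] at hc
      simp only [F]
      have hc' : c ∉ W₂ ⊔ T := fun h => hc (l₂ (e₂ ▸ h))
      rw [if_neg (notle c hc), comap_sup_span_eq_of_notMem hc', if_pos (by rw [e₂] at q₂; omega)]
    -- Vectors in `W₃` give type 3. The others leave `T ⊓ W₁` unchanged: type 0 if it is zero, type
    -- 1 if it is a line.
    · have e₂ : W₂ ⊔ T = W₃ := by
        refine eq_of_le_of_finrank_le (sup_le l₂ hT₃) ?_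
        have := finrank_lt_finrank_of_lt (left_lt_sup.2 hT₂)
        omega
      have n₂ : finrank K (T.comap W₂.subtype) = 1 := by rw [e₂] at q₂; omega
      by_cases n₁ : finrank K (T.comap W₁.subtype) = 0
      · have e₁ : W₁ ⊔ T = W₃ :=
          eq_of_le_of_finrank_le (sup_le (l₁.trans l₂) hT₃) (by omega)
        refine sum_eq_zero_of_split F T W₃ W₁ 1 1 (e₃.trans e₁.symm) ha he n₃ (by omega) key
          fun c hc => ?_
        simp only [F]
        rw [if_neg (notle c (e₁ ▸ hc)), comap_sup_span_eq_of_notMem hc,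
          comap_sup_span_eq_of_notMem (W := W₂) (e₂.symm ▸ e₁ ▸ hc), if_neg (by omega), if_pos n₁,
          one_mul]
      · refine sum_eq_zero_of_split F T W₃ W₂ 1 (p (T.comap W₁.subtype)) (e₃.trans e₂.symm) ha hp'
          n₃ (by omega) key fun c hc => ?_
        simp only [F]
        rw [if_neg (notle c (e₂ ▸ hc)), comap_sup_span_eq_of_notMem hc,
          comap_sup_span_eq_of_notMem (W := W₁) (fun h => hc (sup_le_sup_right l₁ T h)),
          if_neg (by omega), if_neg n₁]
  · have notle : ∀ c, ¬ T ⊔ span K {c} ≤ W₃ := fun c h => hT₃ (le_sup_left.trans h)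
    have hT₂ : finrank K (T.comap W₂.subtype) ≠ 2 := fun h => by
      refine hT₃ (le_trans ?_ l₂)
      have : W₂ = W₂ ⊔ T := eq_of_le_of_finrank_le le_sup_left (by omega)
      rw [this]
      exact le_sup_right
    -- Vectors in `W₂ ⊔ T` enlarge the line `T ⊓ W₂` to a plane (type 2); the others give type 0 or
    -- 1 according to `T ⊓ W₁`.
    by_cases n₂ : finrank K (T.comap W₂.subtype) = 1
    · have key : ∀ c ∈ W₂ ⊔ T, c ∉ T → F (T ⊔ span K {c}) =
          b' (T.map W₃.mkQ) * b ((T ⊔ span K {c}).comap W₂.subtype) := fun c hc hcT => by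
        have q := finrank_sup_add_finrank_comap W₂ (T ⊔ span K {c})
        rw [sup_sup_span_eq_of_mem hc, dim c hcT] at q
        simp only [F]
        rw [if_neg (notle c), if_pos (by omega),
          map_mkQ_sup_span_eq_of_mem (sup_le_sup_right l₂ T hc), mul_comm]
      by_cases n₁ : finrank K (T.comap W₁.subtype) = 0
      · have e₁ : W₁ ⊔ T = W₂ ⊔ T :=
          eq_of_le_of_finrank_le (sup_le_sup_right l₁ T) (by omega)
        refine sum_eq_zero_of_split F T W₂ W₁ _ 1 e₁.symm hb he n₂ (by omega) key fun c hc => ?_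
        simp only [F]
        rw [if_neg (notle c), comap_sup_span_eq_of_notMem hc,
          comap_sup_span_eq_of_notMem (W := W₂) (e₁ ▸ hc), if_neg (by omega), if_pos n₁, one_mul]
      · refine sum_eq_zero_of_split F T W₂ W₂ _ (p (T.comap W₁.subtype)) rfl hb hp' n₂ (by omega)
          key fun c hc => ?_
        simp only [F]
        rw [if_neg (notle c), comap_sup_span_eq_of_notMem hc,
          comap_sup_span_eq_of_notMem (W := W₁) (fun h => hc (sup_le_sup_right l₁ T h)),
          if_neg (by omega), if_neg n₁]
    -- Here `T ⊓ W₂ = 0`, so one further vector cannot produce type 2. Vectors in `W₁ ⊔ T` give type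
    -- 1, the others type 0.
    · have n₁ : finrank K (T.comap W₁.subtype) = 0 := by omega
      have m : ∀ c ∉ T, finrank K ((T ⊔ span K {c}).comap W₂.subtype) ≠ 2 := fun c hc h => by
        have q := finrank_sup_add_finrank_comap W₂ (T ⊔ span K {c})
        rw [dim c hc] at q
        have : finrank K ↥(W₂ ⊔ T) ≤ finrank K ↥(W₂ ⊔ (T ⊔ span K {c})) :=
          finrank_mono (sup_le_sup_left le_sup_left _)
        omega
      refine sum_eq_zero_of_split F T W₁ W₁ (p' (T.map W₂.mkQ)) 1 rfl hp he n₁ (by omega)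
        (fun c hc hcT => ?_) fun c hc => ?_
      · have q := finrank_sup_add_finrank_comap W₁ (T ⊔ span K {c})
        rw [sup_sup_span_eq_of_mem hc, dim c hcT] at q
        simp only [F]
        rw [if_neg (notle c), if_neg (m c hcT), if_neg (by omega),
          map_mkQ_sup_span_eq_of_mem (sup_le_sup_right l₁ T hc), mul_comm]
      · simp only [F]
        rw [if_neg (notle c), if_neg (m c fun h => hc (mem_sup_right h)),
          comap_sup_span_eq_of_notMem hc, if_pos n₁, one_mul]

end

/-! ### From halvings to large sets -/

section LargeSets

variable {K V : Type} [Field K] [Finite K] [AddCommGroup V] [Module K V] [FiniteDimensional K V]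

theorem card_filter_mem_notMem [Fintype V] {T U : Submodule K V} (h : T ≤ U)
    [DecidablePred fun c : V => c ∈ U ∧ c ∉ T] :
    ((Finset.univ.filter fun c : V => c ∈ U ∧ c ∉ T).card : ℤ) =
      (Nat.card K : ℤ) ^ finrank K U - (Nat.card K : ℤ) ^ finrank K T := by
  classical
  have e : (Finset.univ.filter fun c : V => c ∈ U ∧ c ∉ T) =
      (U : Set V).toFinset \ (T : Set V).toFinset := by
    ext c
    simp
  rw [e, Finset.card_sdiff_of_subset (Set.toFinset_subset_toFinset.2 h), Nat.cast_sub
    (Finset.card_le_card (Set.toFinset_subset_toFinset.2 h)), Set.toFinset_card, Set.toFinset_card,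
    ← Nat.cast_pow, ← Nat.cast_pow, ← natCard_eq_pow_finrank, ← natCard_eq_pow_finrank,
    Nat.card_eq_fintype_card, Nat.card_eq_fintype_card]
  rfl

/-- Summing over the vectors outside `T` counts every cover of `T` equally often. -/
theorem finsum_sup_span_eq (T : Submodule K V) {t : ℕ} (hT : finrank K T = t)
    (S : Finset (Submodule K V)) (hS : ∀ U, U ∈ S ↔ finrank K U = t + 1 ∧ T ≤ U)
    (f : Submodule K V → ℤ) :
    ∑ᶠ c : V, (open Classical in if c ∈ T then 0 else f (T ⊔ span K {c})) =
      ((Nat.card K : ℤ) ^ (t + 1) - (Nat.card K : ℤ) ^ t) * ∑ U ∈ S, f U := by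
  classical
  have : Finite V := Module.finite_of_finite K
  have := Fintype.ofFinite V
  have h0 : ∀ c : V, (if c ∈ T then 0 else f (T ⊔ span K {c})) =
      if c ∉ T then f (T ⊔ span K {c}) else 0 := fun c => by split_ifs <;> simp_all
  rw [finsum_eq_sum_of_fintype, Finset.sum_congr rfl fun c _ => h0 c, ← Finset.sum_filter,
    ← Finset.sum_fiberwise_of_maps_to (t := S) (g := fun c => T ⊔ span K {c}), Finset.mul_sum]
  · refine Finset.sum_congr rfl fun U hU => ?_
    obtain ⟨hU, hTU⟩ := (hS U).1 hU
    have h : ((Finset.univ.filter fun c : V => c ∉ T).filter fun c => T ⊔ span K {c} = U) =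
        Finset.univ.filter fun c : V => c ∈ U ∧ c ∉ T := by
      ext c
      simp only [Finset.mem_filter, Finset.mem_univ, true_and]
      constructor
      · rintro ⟨h1, rfl⟩
        exact ⟨mem_sup_right (mem_span_singleton_self c), h1⟩
      · rintro ⟨h1, h2⟩
        refine ⟨h2, eq_of_le_of_finrank_eq
          (sup_le hTU ((span_singleton_le_iff_mem _ _).2 h1)) ?_⟩
        rw [finrank_sup_span_singleton h2, hT, hU]
    rw [Finset.sum_congr rfl (g := fun _ => f U)
      (fun c hc => by rw [(Finset.mem_filter.1 hc).2]), Finset.sum_const, h, nsmul_eq_mul,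
      card_filter_mem_notMem hTU, hU, hT]
  · intro c hc
    rw [Finset.mem_filter] at hc
    rw [hS]
    exact ⟨by rw [finrank_sup_span_singleton hc.2, hT], le_sup_left⟩

/-- The parts are the two sign classes. Cancellation puts half of the covers of `T` in each, and the
number of covers does not depend on `T`. -/
theorem IsHalving.isLargeSet {t : ℕ} {f : Submodule K V → ℤ} (hf : IsHalving K t f)
    (ht : t + 1 ≤ finrank K V) : ∃ L, IsLargeSet K V 2 t (t + 1) L := by
  classical
  have : Finite V := Module.finite_of_finite K
  have := Fintype.ofFinite V
  have : Finite (Submodule K V) := inferInstance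
  have := Fintype.ofFinite (Submodule K V)
  let S : Submodule K V → Finset (Submodule K V) := fun T =>
    Finset.univ.filter fun U => finrank K U = t + 1 ∧ T ≤ U
  let B : ℤ → Set (Submodule K V) := fun s => {U | finrank K U = t + 1 ∧ f U = s}
  let M : ℤ := (Nat.card K : ℤ) ^ (t + 1) - (Nat.card K : ℤ) ^ t
  have hM : 0 < M := by
    have : 1 < (Nat.card K : ℤ) := by exact_mod_cast Finite.one_lt_card
    exact sub_pos.2 (pow_lt_pow_right₀ this (Nat.lt_succ_self t))
  have hS : ∀ T U, U ∈ S T ↔ finrank K U = t + 1 ∧ T ≤ U := by simp [S]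
  have hsum : ∀ T : Submodule K V, finrank K T = t → ∑ U ∈ S T, f U = 0 := fun T hT => by
    have h := finsum_sup_span_eq T hT (S T) (hS T) f
    rw [hf.sum_eq_zero T hT] at h
    exact (mul_eq_zero.1 h.symm).resolve_left hM.ne'
  have hcard : ∀ T : Submodule K V, finrank K T = t →
      M * (S T).card = (Nat.card K : ℤ) ^ finrank K V - (Nat.card K : ℤ) ^ t := fun T hT => by
    -- The constant colouring 1 counts the covers.
    have h := finsum_sup_span_eq T hT (S T) (hS T) fun _ => 1
    rw [Finset.sum_const, nsmul_eq_mul, mul_one] at h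
    rw [← h, finsum_eq_sum_of_fintype]
    have h2 := card_filter_mem_notMem (K := K) (le_top : T ≤ ⊤)
    rw [finrank_top, hT] at h2
    rw [← h2, Finset.card_filter]
    push_cast
    refine Finset.sum_congr rfl fun c _ => ?_
    by_cases hc : c ∈ T <;> simp [hc]
  have hpm : ∀ T : Submodule K V, finrank K T = t →
      ((S T).filter fun U => f U = 1).card = ((S T).filter fun U => f U = -1).card ∧
      ((S T).filter fun U => f U = 1).card + ((S T).filter fun U => f U = -1).card
        = (S T).card := fun T hT => by
    have hneg : ∀ U, f U = -1 ↔ ¬ f U = 1 := fun U => by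
      rcases hf.sign U with h | h <;> simp [h]
    have h1 : ((S T).filter fun U => f U = 1).card + ((S T).filter fun U => f U = -1).card
        = (S T).card := by
      simp only [hneg]
      exact Finset.card_filter_add_card_filter_not _
    refine ⟨?_, h1⟩
    have h2 := hsum T hT
    have h3 : ∀ U, f U = (if f U = 1 then 1 else 0) - (if f U = -1 then 1 else 0) := fun U => by
      rcases hf.sign U with h | h <;> simp [h]
    rw [Finset.sum_congr rfl fun U _ => h3 U, Finset.sum_sub_distrib, ← Finset.sum_filter,
      ← Finset.sum_filter, Finset.sum_const, Finset.sum_const] at h2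
    simp only [nsmul_eq_mul, mul_one] at h2
    omega
  obtain ⟨T₀, hT₀⟩ := exists_finrank_eq_of_le (K := K) (V := V) (n := t) (by omega)
  obtain ⟨U₀, hU₀, hU₀'⟩ := exists_le_finrank_eq_succ (W := T₀) (by omega)
  have hpos : 0 < (S T₀).card := Finset.card_pos.2 ⟨U₀, (hS _ _).2 ⟨by omega, hU₀⟩⟩
  have hne : ∀ s, s = 1 ∨ s = -1 → (B s).Nonempty := by
    have h := hpm T₀ hT₀
    have : ∀ s, 0 < ((S T₀).filter fun U => f U = s).card → (B s).Nonempty := fun s hs => by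
      obtain ⟨U, hU⟩ := Finset.card_pos.1 hs
      rw [Finset.mem_filter, hS] at hU
      exact ⟨U, hU.1.1, hU.2⟩
    rintro s (rfl | rfl)
    · exact this _ (by omega)
    · exact this _ (by omega)
  have hdisj : ∀ s s', s ≠ s' → Disjoint (B s) (B s') := fun s s' h =>
    Set.disjoint_left.2 fun U hU hU' => h (hU.2.symm.trans hU'.2)
  have hB : B 1 ≠ B (-1) := fun h => by
    have := hdisj 1 (-1) (by norm_num)
    rw [h, disjoint_self] at this
    exact (hne (-1) (Or.inr rfl)).ne_empty this
  refine ⟨{B 1, B (-1)}, ?_, ?_, ?_, Set.encard_pair hB,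
    ((S T₀).filter fun U => f U = 1).card, ?_⟩
  · rintro _ (rfl | rfl)
    exacts [hne _ (Or.inl rfl), hne _ (Or.inr rfl)]
  · rintro _ (rfl | rfl) _ (rfl | rfl) h
    exacts [(h rfl).elim, hdisj _ _ (by norm_num), hdisj _ _ (by norm_num), (h rfl).elim]
  · ext U
    simp only [Set.sUnion_insert, Set.sUnion_singleton, Set.mem_union, B, Set.mem_ofPred_eq,
      grassmannian, ← and_or_left, hf.sign U, and_true]
  · have key : ∀ s, s = 1 ∨ s = -1 → ∀ T ∈ grassmannian K V t,
        {U ∈ B s | T ≤ U}.encard = ((S T₀).filter fun U => f U = 1).card := by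
      intro s hs T hT
      have e : {U ∈ B s | T ≤ U} = ((S T).filter fun U => f U = s : Finset _) := by
        ext U
        simp only [B, S, Finset.coe_filter, Finset.mem_filter, Finset.mem_univ, true_and,
          Set.mem_ofPred_eq]
        tauto
      rw [e, Set.encard_coe_eq_coe_finsetCard]
      have h1 := hpm T hT
      have h2 := hpm T₀ hT₀
      have h3 : (S T).card = (S T₀).card := by
        have := (hcard T hT).trans (hcard T₀ hT₀).symm
        exact_mod_cast mul_left_cancel₀ hM.ne' this
      refine congrArg Nat.cast ?_
      rcases hs with rfl | rfl <;> omega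
    rintro _ (rfl | rfl)
    · exact ⟨fun U hU => hU.1, key _ (Or.inl rfl)⟩
    · exact ⟨fun U hU => hU.1, key _ (Or.inr rfl)⟩

end LargeSets

theorem HasHalvings.infinite_largeSetRealizable {K : Type} [Field K] [Finite K]
    (h6 : HasHalvings K 2 6) :
    {p : ℕ × ℕ × ℕ × ℕ | ∃ q N k v : ℕ, p = (q, N, k, v) ∧ 2 ≤ N ∧ 2 ≤ k ∧ k ≤ v ∧
      LargeSetRealizable q N 2 k v}.Infinite := by
  have h : ∀ m, HasHalvings K 2 (4 * m + 6) := fun m => by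
    induction m with
    | zero => exact h6
    | succ m ih => exact HasHalvings.extend (w := 4 * m + 4) h6 ih
  refine Set.infinite_of_injective_forall_mem (f := fun m : ℕ => (Nat.card K, 2, 3, 4 * m + 6))
    (fun m m' hm => ?_) fun m => ⟨_, _, _, _, rfl, le_rfl, by norm_num, by omega, ?_⟩
  · simp only [Prod.mk.injEq, true_and] at hm
    omega
  · have hr : finrank K (Fin (4 * m + 6) → K) = 4 * m + 6 := by simp
    obtain ⟨f, hf⟩ := h m _ hr
    obtain ⟨L, hL⟩ := hf.isLargeSet (by omega)
    exact ⟨K, inferInstance, inferInstance, _, inferInstance, inferInstance, inferInstance, L, rfl,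
      hr, hL⟩

/-! ### The ring structure on 729 elements -/

/-- The field with `729` elements, as `𝔽₂₇(i)` with `i² = -1` and `𝔽₂₇ = 𝔽₃(t)`, `t³ = t + 1`,
in the coordinates `1, t, t², i, i t, i t²`. -/
def GF729 : Type := Fin 6 → ZMod 3

namespace GF729

instance : AddCommGroup GF729 := inferInstanceAs (AddCommGroup (Fin 6 → ZMod 3))
instance : Module (ZMod 3) GF729 := inferInstanceAs (Module (ZMod 3) (Fin 6 → ZMod 3))
instance : Module.Finite (ZMod 3) GF729 :=
  inferInstanceAs (Module.Finite (ZMod 3) (Fin 6 → ZMod 3))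
instance : Fintype GF729 := inferInstanceAs (Fintype (Fin 6 → ZMod 3))
instance : DecidableEq GF729 := inferInstanceAs (DecidableEq (Fin 6 → ZMod 3))

theorem finrank_eq : finrank (ZMod 3) GF729 = 6 :=
  Module.finrank_fin_fun (ZMod 3)

theorem card_eq : Fintype.card GF729 = 729 := by
  have : Fintype.card (Fin 6 → ZMod 3) = 729 := by simp [ZMod.card]
  exact this

/-- The coordinates of a product, over any commutative ring. -/
def mulCoords {R : Type} [CommRing R] (x y : Fin 6 → R) : Fin 6 → R :=
  ![x 0 * y 0 + x 1 * y 2 + x 2 * y 1 + 2 * (x 3 * y 3 + x 4 * y 5 + x 5 * y 4),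
    x 0 * y 1 + x 1 * y 0 + x 1 * y 2 + x 2 * y 1 + x 2 * y 2 +
      2 * (x 3 * y 4 + x 4 * y 3 + x 4 * y 5 + x 5 * y 4 + x 5 * y 5),
    x 0 * y 2 + x 1 * y 1 + x 2 * y 0 + x 2 * y 2 +
      2 * (x 3 * y 5 + x 4 * y 4 + x 5 * y 3 + x 5 * y 5),
    x 0 * y 3 + x 1 * y 5 + x 2 * y 4 + x 3 * y 0 + x 4 * y 2 + x 5 * y 1,
    x 0 * y 4 + x 1 * y 3 + x 1 * y 5 + x 2 * y 4 + x 2 * y 5 +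
      x 3 * y 1 + x 4 * y 0 + x 4 * y 2 + x 5 * y 1 + x 5 * y 2,
    x 0 * y 5 + x 1 * y 4 + x 2 * y 3 + x 2 * y 5 +
      x 3 * y 2 + x 4 * y 1 + x 5 * y 0 + x 5 * y 2]

section MulCoords

variable {R : Type} [CommRing R] (x y z : Fin 6 → R)

/-- The formulas describe `R[t, i]` modulo `t³ = t + 1` and `i² = 2`, so the ring laws are
polynomial identities over every `R`; only `2 = -1` is special to characteristic 3. -/
theorem mulCoords_assoc :
    mulCoords (mulCoords x y) z = mulCoords x (mulCoords y z) := by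
  funext j
  fin_cases j <;> simp [mulCoords] <;> ring

theorem mulCoords_comm : mulCoords x y = mulCoords y x := by
  funext j
  fin_cases j <;> simp [mulCoords] <;> ring

theorem mulCoords_add : mulCoords x (y + z) = mulCoords x y + mulCoords x z := by
  funext j
  fin_cases j <;> simp [mulCoords] <;> ring

theorem add_mulCoords : mulCoords (x + y) z = mulCoords x z + mulCoords y z := by
  rw [mulCoords_comm, mulCoords_add, mulCoords_comm z x, mulCoords_comm z y]

theorem mulCoords_smul (r : R) : mulCoords x (r • y) = r • mulCoords x y := by
  funext j
  fin_cases j <;> simp [mulCoords] <;> ring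

theorem one_mulCoords : mulCoords ![1, 0, 0, 0, 0, 0] x = x := by
  funext j
  fin_cases j <;> simp [mulCoords]

end MulCoords

theorem zero_mulCoords {R : Type} [CommRing R] (x : Fin 6 → R) : mulCoords 0 x = 0 := by
  funext j
  fin_cases j <;> simp [mulCoords]

instance : CommRing GF729 :=
  { (inferInstance : AddCommGroup GF729) with
    mul := fun x y => mulCoords (R := ZMod 3) x y
    one := (![1, 0, 0, 0, 0, 0] : Fin 6 → ZMod 3)
    mul_assoc := mulCoords_assoc (R := ZMod 3)
    mul_comm := mulCoords_comm (R := ZMod 3)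
    left_distrib := mulCoords_add (R := ZMod 3)
    right_distrib := add_mulCoords (R := ZMod 3)
    one_mul := one_mulCoords (R := ZMod 3)
    mul_one := fun x => (mulCoords_comm (R := ZMod 3) _ _).trans (one_mulCoords (R := ZMod 3) x)
    zero_mul := zero_mulCoords (R := ZMod 3)
    mul_zero := fun x => (mulCoords_comm (R := ZMod 3) _ _).trans (zero_mulCoords (R := ZMod 3) x) }

theorem mul_def (x y : GF729) : x * y = mulCoords (R := ZMod 3) x y := rfl

instance : Algebra (ZMod 3) GF729 :=
  Algebra.ofModule
    (fun r x y => by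
      rw [mul_comm, mul_comm x y]
      exact mulCoords_smul (R := ZMod 3) y x r)
    fun r x y => mulCoords_smul (R := ZMod 3) x y r

instance : Nontrivial GF729 := inferInstanceAs (Nontrivial (Fin 6 → ZMod 3))

instance : CharP GF729 3 := charP_of_injective_algebraMap (algebraMap (ZMod 3) GF729).injective 3

end GF729

/-! ### Coordinate arithmetic and discrete logarithms -/

/-- Sextuples of natural numbers, used to calculate with coordinates in `GF729`. -/
structure NatSextuple where
  a : ℕ
  b : ℕ
  c : ℕ
  p : ℕ
  q : ℕ
  r : ℕ

namespace NatSextuple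

/-- The element of `GF729` with the given coordinates. -/
def toGF (x : NatSextuple) : GF729 :=
  (![(x.a : ZMod 3), (x.b : ZMod 3), (x.c : ZMod 3), (x.p : ZMod 3), (x.q : ZMod 3),
    (x.r : ZMod 3)] : Fin 6 → ZMod 3)

def add (x y : NatSextuple) : NatSextuple :=
  ⟨x.a + y.a, x.b + y.b, x.c + y.c, x.p + y.p, x.q + y.q, x.r + y.r⟩

/-- Doubling replaces negation modulo 3 and avoids truncated subtraction. -/
def sub (x y : NatSextuple) : NatSextuple :=
  ⟨(x.a + 2 * y.a) % 3, (x.b + 2 * y.b) % 3, (x.c + 2 * y.c) % 3, (x.p + 2 * y.p) % 3,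
    (x.q + 2 * y.q) % 3, (x.r + 2 * y.r) % 3⟩

def mul (x y : NatSextuple) : NatSextuple :=
  ⟨(x.a * y.a + x.b * y.c + x.c * y.b + 2 * (x.p * y.p + x.q * y.r + x.r * y.q)) % 3,
    (x.a * y.b + x.b * y.a + x.b * y.c + x.c * y.b + x.c * y.c +
      2 * (x.p * y.q + x.q * y.p + x.q * y.r + x.r * y.q + x.r * y.r)) % 3,
    (x.a * y.c + x.b * y.b + x.c * y.a + x.c * y.c +
      2 * (x.p * y.r + x.q * y.q + x.r * y.p + x.r * y.r)) % 3,
    (x.a * y.p + x.b * y.r + x.c * y.q + x.p * y.a + x.q * y.c + x.r * y.b) % 3,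
    (x.a * y.q + x.b * y.p + x.b * y.r + x.c * y.q + x.c * y.r +
      x.p * y.b + x.q * y.a + x.q * y.c + x.r * y.b + x.r * y.c) % 3,
    (x.a * y.r + x.b * y.q + x.c * y.p + x.c * y.r +
      x.p * y.c + x.q * y.b + x.r * y.a + x.r * y.c) % 3⟩

def cube (x : NatSextuple) : NatSextuple := mul x (mul x x)

/-- The number with the given residues modulo `3` as digits. -/
def code (x : NatSextuple) : ℕ :=
  x.a % 3 + 3 * (x.b % 3) + 9 * (x.c % 3) + 27 * (x.p % 3) + 81 * (x.q % 3) + 243 * (x.r % 3)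

theorem toGF_add (x y : NatSextuple) : (add x y).toGF = x.toGF + y.toGF := by
  show (_ : Fin 6 → ZMod 3) = (fun j => _ + _)
  funext j
  fin_cases j <;> simp [toGF, add]

theorem toGF_sub (x y : NatSextuple) : (sub x y).toGF = x.toGF - y.toGF := by
  have h2 : (2 : ZMod 3) = -1 := by decide
  show (_ : Fin 6 → ZMod 3) = (fun j => _ - _)
  funext j
  fin_cases j <;> simp [toGF, sub, h2, sub_eq_add_neg]

theorem toGF_mul (x y : NatSextuple) : (mul x y).toGF = x.toGF * y.toGF := by
  rw [GF729.mul_def]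
  show (_ : Fin 6 → ZMod 3) = _
  funext j
  fin_cases j <;> simp [toGF, mul, GF729.mulCoords]

theorem toGF_cube (x : NatSextuple) : (cube x).toGF = x.toGF ^ 3 := by
  rw [cube, toGF_mul, toGF_mul, pow_three]

theorem toGF_one : toGF ⟨1, 0, 0, 0, 0, 0⟩ = 1 := by
  show (_ : Fin 6 → ZMod 3) = ![1, 0, 0, 0, 0, 0]
  simp [toGF]

theorem toGF_zero : toGF ⟨0, 0, 0, 0, 0, 0⟩ = 0 := by
  show (_ : Fin 6 → ZMod 3) = fun _ => 0
  funext j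
  fin_cases j <;> simp [toGF]

end NatSextuple

/-- Discrete logarithms in `GF729`, packed with ten bits for each element. -/
def logTable : ℕ :=
  9062765137280470189524861542911831888909916872145263456051159058428864248934096151968659509242206522661070232566145099217678132983995999540571479471191816825105195136136120710872681523281332998575251797989112835328123918816848015566984991351401519190838673035583047049210256259886890196823454692370732313459764880413975988794535202846741098071112832587969654757962003896383445158008999790930816076909394329745376462890729647345021354642033652498579423331620882416399573159428941158849828180949414946310173458020320147892025811437477593187608441042403174047105261592617064274104601462709336144691322102716610855310255449024292795946874293916861568433791211356196887379602906935334848762419689854953933808845803193211461182195180475816288698003087376436308140048807907031991563565055567367015424805084086125115099959575158014061337568338564812976234656918772177856616285857616669707259652136395354124302627192433236910122355579850803585023192094180478097838844561486770126783288901413917662554987915620890807183703185851321025162565817260325202014435812200099332597095798678445729820481880305722031525610778927883712982604802894016698643842509602634384899507217549500119427784727095945548654074204032510415763784297315680178866604878075868416011229294679133625382937482400919293433997846114469928907792485595274506357314288218279669128145780120526277501365998223448144673343325804900160861835850254539204172886298905590824213628066901806828578140565371036822070898421974768598605628690404701311417769826401270231862237767659914613324687099421568184509585465203430047740767973964075490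749617967025509535427037458784147821530224088275204186839688400215591126620299440129400443826746793412640079731673526929823119773706444412942018220539690431714231782426556997360972263048199645943327756562077915778084275403240859320566758753792591466416843419657346551724854390501080849341279616428297641067090517922606674882841039099408635653577320557923172744317387743163572079439822324357898680210476343104260941946797298594095731332613581792472450131560128140764352255502701331201788029261581172631368863745394189732051626901163088080885619058051580497197704682899113686421558815042949708287075837397558099968

/-- The logarithm of the element with code `n`. -/
def logOfCode (n : ℕ) : ℕ := Nat.shiftRight logTable (10 * n) % 1024

namespace GF729

/-- The number with the coordinates as digits. -/
def code (x : GF729) : ℕ :=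
  (x 0).val + 3 * (x 1).val + 9 * (x 2).val + 27 * (x 3).val + 81 * (x 4).val + 243 * (x 5).val

theorem code_toGF (x : NatSextuple) : code x.toGF = x.code := by
  simp [code, NatSextuple.code, NatSextuple.toGF, ZMod.val_natCast]

theorem code_injective : Function.Injective code := by
  intro x y hxy
  have hx : ∀ z : ZMod 3, z.val < 3 := ZMod.val_lt
  have := hx (x 0); have := hx (x 1); have := hx (x 2); have := hx (x 3); have := hx (x 4)
  have := hx (x 5); have := hx (y 0); have := hx (y 1); have := hx (y 2); have := hx (y 3)
  have := hx (y 4); have := hx (y 5)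
  simp only [code] at hxy
  refine funext fun j => ZMod.val_injective 3 ?_
  fin_cases j <;> simp <;> omega

theorem code_eq_zero {x : GF729} : code x = 0 ↔ x = 0 :=
  code_injective.eq_iff' rfl

/-- The generator `t² + i t` of the multiplicative group. -/
def gen : GF729 := NatSextuple.toGF ⟨0, 0, 1, 0, 1, 0⟩

/-- The discrete logarithm with respect to `gen`. -/
def dlog (x : GF729) : ℕ := logOfCode (code x)

/-- Tests that `x, gen * x, gen² * x, …` have logarithms `i, i + 1, i + 2, …`. -/
def checkLog : ℕ → NatSextuple → ℕ → Bool
  | 0, x, _ => Nat.beq x.code 1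
  | n + 1, x, i => Nat.beq (logOfCode x.code) i &&
      checkLog n (NatSextuple.mul ⟨0, 0, 1, 0, 1, 0⟩ x) (i + 1)

/-- The table is only a certificate: one walk along the powers of `gen` validates its entries and
confirms that the walk ends at 1. -/
theorem dlog_of_checkLog {n : ℕ} : ∀ {x : NatSextuple} {i : ℕ}, checkLog n x i = true →
    (∀ m < n, dlog (gen ^ m * x.toGF) = i + m) ∧ code (gen ^ n * x.toGF) = 1 := by
  induction n with
  | zero =>
    intro x i h
    refine ⟨fun m hm => absurd hm (Nat.not_lt_zero m), ?_⟩
    rw [pow_zero, one_mul, code_toGF]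
    exact Nat.eq_of_beq_eq_true h
  | succ n ih =>
    intro x i h
    rw [checkLog, Bool.and_eq_true] at h
    obtain ⟨h1, h2⟩ := ih h.2
    rw [NatSextuple.toGF_mul] at h1 h2
    have e : ∀ m, gen ^ (m + 1) * x.toGF =
        gen ^ m * (NatSextuple.toGF ⟨0, 0, 1, 0, 1, 0⟩ * x.toGF) := fun m => by
      rw [pow_succ, mul_assoc]; rfl
    refine ⟨fun m hm => ?_, by rw [e, h2]⟩
    cases m with
    | zero =>
      rw [pow_zero, one_mul, dlog, code_toGF]
      exact Nat.eq_of_beq_eq_true h.1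
    | succ m =>
      rw [e, h1 m (by omega)]
      omega

theorem checkLog_eq_true : checkLog 728 ⟨1, 0, 0, 0, 0, 0⟩ 0 = true := by decide +kernel

theorem dlog_gen_pow_of_lt {m : ℕ} (hm : m < 728) : dlog (gen ^ m) = m := by
  have h := (dlog_of_checkLog checkLog_eq_true).1 m hm
  rwa [NatSextuple.toGF_one, mul_one, zero_add] at h

theorem gen_pow_card : gen ^ 728 = 1 := by
  have h := (dlog_of_checkLog checkLog_eq_true).2
  rw [NatSextuple.toGF_one, mul_one] at h
  exact code_injective h

theorem gen_pow_ne_zero (m : ℕ) : gen ^ m ≠ 0 := by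
  have : IsUnit gen := IsUnit.of_pow_eq_one gen_pow_card (by norm_num)
  exact (this.pow m).ne_zero

/-- `dlog` recovers the exponent, so the 728 powers are distinct; being nonzero, they exhaust the
nonzero elements. The absence of zero divisors follows from this. -/
theorem exists_eq_gen_pow {x : GF729} (hx : x ≠ 0) : ∃ m < 728, x = gen ^ m := by
  have h : (Finset.range 728).image (fun m => gen ^ m) = Finset.univ.erase (0 : GF729) := by
    refine Finset.eq_of_subset_of_card_le (fun y hy => ?_) ?_
    · obtain ⟨m, -, rfl⟩ := Finset.mem_image.1 hy
      exact Finset.mem_erase.2 ⟨gen_pow_ne_zero m, Finset.mem_univ _⟩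
    · rw [Finset.card_erase_of_mem (Finset.mem_univ _), Finset.card_univ, card_eq,
        Finset.card_image_of_injOn, Finset.card_range]
      intro m hm m' hm' h
      rw [← dlog_gen_pow_of_lt (Finset.mem_range.1 hm),
        ← dlog_gen_pow_of_lt (Finset.mem_range.1 hm')]
      exact congrArg dlog h
  have hx' : x ∈ Finset.univ.erase (0 : GF729) := Finset.mem_erase.2 ⟨hx, Finset.mem_univ _⟩
  rw [← h] at hx'
  obtain ⟨m, hm, rfl⟩ := Finset.mem_image.1 hx'
  exact ⟨m, Finset.mem_range.1 hm, rfl⟩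

theorem dlog_gen_pow (m : ℕ) : dlog (gen ^ m) = m % 728 := by
  rw [pow_eq_pow_mod m gen_pow_card, dlog_gen_pow_of_lt (Nat.mod_lt _ (by norm_num))]

instance : IsDomain GF729 :=
  have : NoZeroDivisors GF729 := ⟨fun {x y} h => by
    by_contra! hxy
    obtain ⟨m, -, rfl⟩ := exists_eq_gen_pow hxy.1
    obtain ⟨n, -, rfl⟩ := exists_eq_gen_pow hxy.2
    rw [← pow_add] at h
    exact gen_pow_ne_zero _ h⟩
  NoZeroDivisors.to_isDomain _

end GF729

/-! ### Sums over linear combinations modulo 3 -/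

section TreeSum

variable {W : Type} [AddCommGroup W]

/-- The sum of `G` over all `x + ∑ cᵢ wᵢ` with coefficients `cᵢ ∈ {0, 1, 2}`. -/
def treeSum (G : W → ℕ) : List W → W → ℕ
  | [], x => G x
  | w :: l, x => treeSum G l x + treeSum G l (x + w) + treeSum G l (x + w + w)

theorem treeSum_append_zero_cons (G : W → ℕ) (l l' : List W) (x : W) :
    treeSum G (l ++ 0 :: l') x = 3 * treeSum G (l ++ l') x := by
  induction l generalizing x with
  | nil =>
    simp only [List.nil_append, treeSum, add_zero]
    ring
  | cons w l ih =>
    simp only [List.cons_append, treeSum, ih]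
    ring

theorem sum_pi_zmod_three [Module (ZMod 3) W] (G : W → ℕ) {n : ℕ} (w : Fin n → W) (x : W) :
    ∑ c : Fin n → ZMod 3, G (x + ∑ i, c i • w i) = treeSum G (List.ofFn w) x := by
  induction n generalizing x with
  | zero => simp [treeSum]
  | succ n ih =>
    rw [← (Fin.consEquiv fun _ => ZMod 3).sum_comp, Fintype.sum_prod_type, List.ofFn_succ, treeSum]
    have h : ∀ a : ZMod 3, ∑ c : Fin n → ZMod 3,
        G (x + ∑ i, (Fin.consEquiv fun _ => ZMod 3) (a, c) i • w i) =
        treeSum G (List.ofFn fun i => w i.succ) (x + a • w 0) := fun a => by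
      rw [← ih]
      refine Finset.sum_congr rfl fun c _ => ?_
      simp [Fin.sum_univ_succ, Fin.consEquiv, add_assoc]
    rw [Finset.sum_congr rfl fun a _ => h a]
    have e : ∀ g : ZMod 3 → ℕ, ∑ a, g a = g 0 + g 1 + g 2 := Fin.sum_univ_three
    rw [e, zero_smul, one_smul, add_zero, show (2 : ZMod 3) = 1 + 1 from rfl, add_smul, one_smul,
      ← add_assoc]

/-- If `L b = 0` and `b k = 1`, the `k`-th coordinate can be eliminated from a sum over `L c`. -/
theorem sum_eq_sum_update [Module (ZMod 3) W] (G : W → ℕ) {n : ℕ}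
    (L : (Fin n → ZMod 3) →ₗ[ZMod 3] W) {b : Fin n → ZMod 3} {k : Fin n} (hb : b k = 1)
    (hL : L b = 0) : ∑ c, G (L c) = ∑ c, G (L (Function.update c k 0)) := by
  -- A shear that keeps the `k`-th coordinate, hence a bijection. Clearing that coordinate
  -- afterwards leaves `c - c k • b`, where `L` takes the value `L c`.
  let τ : (Fin n → ZMod 3) → (Fin n → ZMod 3) := fun c => c - c k • b + Pi.single k (c k)
  have hk : ∀ c, τ c k = c k := fun c => by simp [τ, hb]
  have hτ : Function.Bijective τ := by
    refine Finite.injective_iff_bijective.1 fun c c' h => ?_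
    have h' : c k = c' k := by rw [← hk c, ← hk c', h]
    simpa only [τ, h', add_left_inj, sub_left_inj] using h
  rw [← hτ.sum_comp fun c => G (L (Function.update c k 0))]
  refine Finset.sum_congr rfl fun c _ => ?_
  have e : Function.update (τ c) k 0 = c - c k • b := by
    funext j
    by_cases hj : j = k
    · subst hj
      simp [hb]
    · simp [τ, hj]
  rw [e, map_sub, map_smul, hL, smul_zero, sub_zero]

theorem sum_eq_treeSum_update [Module (ZMod 3) W] (G : W → ℕ) {n : ℕ}
    (L : (Fin n → ZMod 3) →ₗ[ZMod 3] W) {b : Fin n → ZMod 3} {k : Fin n} (hb : b k = 1)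
    (hL : L b = 0) :
    ∑ c, G (L c) = treeSum G (List.ofFn fun i => if i = k then 0 else L (Pi.single i 1)) 0 := by
  rw [sum_eq_sum_update G L hb hL, ← sum_pi_zmod_three]
  refine Finset.sum_congr rfl fun c _ => ?_
  rw [zero_add]
  congr 1
  have e : Function.update c k 0 = ∑ i, c i • (if i = k then 0 else Pi.single i 1) := by
    funext j
    rw [Finset.sum_apply, Finset.sum_eq_single j]
    · by_cases hj : j = k <;> simp [hj]
    · intro i _ hij
      by_cases hi : i = k <;> simp [hi, hij.symm]
    · simp
  rw [e, map_sum]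
  refine Finset.sum_congr rfl fun i _ => ?_
  rw [map_smul]
  split_ifs <;> simp

end TreeSum

/-! ### The sign of a pair of field elements -/

namespace GF729

/-- The colours of the residue classes modulo `728`, as the bits of a number. -/
def colourTable : ℕ :=
  5260135901548410955753579325858485302374814682056440388144992718468148616344947729565073899073154623742567010798496970049640139747943134440708950190959988034428900484170659300045078921273380380101191030594863104

/-- The colour (`0` or `2`, and `1` if undefined) of a pair of field elements with given codes. -/
def weightOfCodes (m n : ℕ) : ℕ :=
  cond (Nat.beq m 0) 1 (cond (Nat.beq n 0) (2 * ((logOfCode m + 1) % 2))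
    (2 * ((Nat.shiftRight colourTable ((81 * logOfCode m + 13 * logOfCode n) % 728) +
      logOfCode m) % 2)))

def weight (x y : GF729) : ℕ := weightOfCodes (code x) (code y)

/-- The sign of a pair of field elements. -/
def sgn (x y : GF729) : ℤ := weight x y - 1

/-- The default weight 1 makes linearly dependent triples contribute nothing. -/
theorem sgn_zero (y : GF729) : sgn 0 y = 0 := rfl

theorem beq_code_eq_false {x : GF729} (hx : x ≠ 0) : Nat.beq (code x) 0 = false := by
  rw [Bool.eq_false_iff]
  exact fun h => hx (code_eq_zero.1 (Nat.eq_of_beq_eq_true h))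

theorem sgn_gen_pow_zero (m : ℕ) : sgn (gen ^ m) 0 = 2 * ((m + 1) % 2 : ℕ) - 1 := by
  have h : weight (gen ^ m) 0 = 2 * ((dlog (gen ^ m) + 1) % 2) := by
    rw [weight, weightOfCodes, beq_code_eq_false (gen_pow_ne_zero m)]
    rfl
  rw [sgn, h, dlog_gen_pow]
  omega

theorem sgn_gen_pow_gen_pow (m n : ℕ) : sgn (gen ^ m) (gen ^ n) =
    2 * ((Nat.shiftRight colourTable ((81 * m + 13 * n) % 728) + m) % 2 : ℕ) - 1 := by
  have h : weight (gen ^ m) (gen ^ n) = 2 * ((Nat.shiftRight colourTable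
      ((81 * dlog (gen ^ m) + 13 * dlog (gen ^ n)) % 728) + dlog (gen ^ m)) % 2) := by
    rw [weight, weightOfCodes, beq_code_eq_false (gen_pow_ne_zero m),
      beq_code_eq_false (gen_pow_ne_zero n)]
    rfl
  rw [sgn, h, dlog_gen_pow, dlog_gen_pow,
    show (81 * (m % 728) + 13 * (n % 728)) % 728 = (81 * m + 13 * n) % 728 by omega]
  omega

theorem sgn_eq {x : GF729} (hx : x ≠ 0) (y : GF729) : sgn x y = 1 ∨ sgn x y = -1 := by
  obtain ⟨m, -, rfl⟩ := exists_eq_gen_pow hx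
  by_cases hy : y = 0
  · subst hy
    rw [sgn_gen_pow_zero]
    omega
  · obtain ⟨n, -, rfl⟩ := exists_eq_gen_pow hy
    rw [sgn_gen_pow_gen_pow]
    omega

/-- The exponents 13 and 31 are `1 + 3 + 9` and `1 + 3 + 27`, the degrees of the Moore determinants.
The table index is invariant since `81 * 13 + 13 * 31 = 2 * 728`, while the logarithm of the first
entry changes parity with `l`. -/
theorem sgn_gen_pow_mul (l : ℕ) (x y : GF729) :
    sgn (gen ^ (13 * l) * x) (gen ^ (31 * l) * y) = (1 - 2 * (l % 2 : ℕ)) * sgn x y := by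
  by_cases hx : x = 0
  · rw [hx, mul_zero, sgn_zero, sgn_zero, mul_zero]
  obtain ⟨m, -, rfl⟩ := exists_eq_gen_pow hx
  by_cases hy : y = 0
  · subst hy
    rw [mul_zero, ← pow_add, sgn_gen_pow_zero, sgn_gen_pow_zero]
    rcases Nat.mod_two_eq_zero_or_one l with h | h <;> rw [h] <;> push_cast <;> omega
  · obtain ⟨n, -, rfl⟩ := exists_eq_gen_pow hy
    rw [← pow_add, ← pow_add, sgn_gen_pow_gen_pow, sgn_gen_pow_gen_pow,
      show (81 * (13 * l + m) + 13 * (31 * l + n)) % 728 = (81 * m + 13 * n) % 728 by omega]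
    rcases Nat.mod_two_eq_zero_or_one l with h | h <;> rw [h] <;> push_cast <;> omega

theorem gen_pow_364 : gen ^ 364 = -1 := by
  have h : (gen ^ 364) * (gen ^ 364) = 1 := by
    rw [← pow_add]
    exact gen_pow_card
  refine (mul_self_eq_one_iff.1 h).resolve_left fun h1 => ?_
  have h2 := dlog_gen_pow 364
  rw [h1, ← pow_zero gen, dlog_gen_pow] at h2
  omega

theorem sgn_neg (x y : GF729) : sgn (-x) (-y) = sgn x y := by
  have h := sgn_gen_pow_mul 364 x y
  rw [mul_comm 13, mul_comm 31, pow_mul, pow_mul, gen_pow_364] at h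
  simpa [Odd.neg_one_pow (show Odd 13 by decide), Odd.neg_one_pow (show Odd 31 by decide)] using h

end GF729

/-! ### Moore determinants -/

namespace GF729

theorem smul_pow_three_pow (r : ZMod 3) (x : GF729) (k : ℕ) :
    (r • x) ^ 3 ^ k = r • x ^ 3 ^ k := by
  rw [smul_pow, ZMod.pow_card_pow]

/-- The matrix of Frobenius powers of three elements. -/
def mooreMatrix (e : Fin 3 → ℕ) (v : Fin 3 → GF729) : Matrix (Fin 3) (Fin 3) GF729 :=
  Matrix.of fun i j => v i ^ 3 ^ e j

theorem mooreMatrix_sum_smul (e : Fin 3 → ℕ) (v : Fin 3 → GF729)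
    (A : Matrix (Fin 3) (Fin 3) (ZMod 3)) :
    mooreMatrix e (fun i => ∑ j, A i j • v j) =
      A.map (algebraMap (ZMod 3) GF729) * mooreMatrix e v := by
  ext i j
  simp only [mooreMatrix, Matrix.of_apply, Matrix.mul_apply, Matrix.map_apply, sum_pow_char_pow,
    smul_pow_three_pow]
  simp only [Algebra.smul_def]

/-- Frobenius powers are linear over the prime field, so a base change multiplies the Moore matrix
by `A`, whatever the exponents. -/
theorem det_mooreMatrix_sum_smul (e : Fin 3 → ℕ) (v : Fin 3 → GF729)
    (A : Matrix (Fin 3) (Fin 3) (ZMod 3)) :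
    (mooreMatrix e (fun i => ∑ j, A i j • v j)).det = A.det • (mooreMatrix e v).det := by
  rw [mooreMatrix_sum_smul, Matrix.det_mul, Algebra.smul_def, RingHom.map_det]
  rfl

/-- The sign of a triple of field elements. -/
def tripleSgn (v : Fin 3 → GF729) : ℤ :=
  sgn (mooreMatrix ![0, 1, 2] v).det (mooreMatrix ![0, 1, 3] v).det

theorem tripleSgn_sum_smul (v : Fin 3 → GF729) (A : Matrix (Fin 3) (Fin 3) (ZMod 3)) :
    tripleSgn (fun i => ∑ j, A i j • v j) = if A.det = 0 then 0 else tripleSgn v := by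
  rw [tripleSgn, det_mooreMatrix_sum_smul, det_mooreMatrix_sum_smul]
  have h : ∀ r : ZMod 3, r = 0 ∨ r = 1 ∨ r = -1 := by decide
  rcases h A.det with h | h | h
  · rw [h, zero_smul, sgn_zero, if_pos rfl]
  · rw [h, one_smul, one_smul, if_neg (by decide)]
    rfl
  · rw [h, neg_one_smul, neg_one_smul, sgn_neg, if_neg (by decide)]
    rfl

theorem det_mooreMatrix_scaled (a b c : GF729) (k : ℕ) :
    (mooreMatrix ![0, 1, k] ![a, a * b, a * c]).det = a ^ (4 + 3 ^ k) *
      ((b ^ 3 - b) * (c ^ 3 ^ k - c ^ 3) - (c ^ 3 - c) * (b ^ 3 ^ k - b ^ 3)) := by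
  rw [Matrix.det_fin_three]
  simp [mooreMatrix]
  ring

/-- The Moore determinants of `1, b, c` as functions of `c`. -/
def mooreMap (b : GF729) : GF729 →ₗ[ZMod 3] GF729 × GF729 where
  toFun c := ((b ^ 3 - b) * (c ^ 9 - c ^ 3) - (c ^ 3 - c) * (b ^ 9 - b ^ 3),
    (b ^ 3 - b) * (c ^ 27 - c ^ 3) - (c ^ 3 - c) * (b ^ 27 - b ^ 3))
  map_add' c d := by
    have h1 := add_pow_char_pow (p := 3) (n := 1) c d
    have h2 := add_pow_char_pow (p := 3) (n := 2) c d
    have h3 := add_pow_char_pow (p := 3) (n := 3) c d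
    norm_num at h1 h2 h3
    rw [h1, h2, h3]
    ext <;> simp only [Prod.mk_add_mk] <;> ring
  map_smul' r c := by
    have h1 := smul_pow_three_pow r c 1
    have h2 := smul_pow_three_pow r c 2
    have h3 := smul_pow_three_pow r c 3
    norm_num at h1 h2 h3
    rw [h1, h2, h3]
    simp only [RingHom.id_apply, Prod.smul_mk]
    simp only [Algebra.smul_def]
    ext <;> dsimp only <;> ring

/-- Reduces every plane to one containing 1: `ε` does not depend on `b` and `c`. -/
theorem tripleSgn_scaled {a : GF729} (ha : a ≠ 0) : ∃ ε : ℤ, ∀ b c : GF729,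
    tripleSgn ![a, a * b, a * c] = ε * sgn (mooreMap b c).1 (mooreMap b c).2 := by
  obtain ⟨l, -, rfl⟩ := exists_eq_gen_pow ha
  refine ⟨1 - 2 * (l % 2 : ℕ), fun b c => ?_⟩
  rw [tripleSgn, det_mooreMatrix_scaled, det_mooreMatrix_scaled, ← pow_mul, ← pow_mul,
    mul_comm l, mul_comm l]
  exact sgn_gen_pow_mul l _ _

theorem exists_algebraMap_of_cube_eq {x : GF729} (h : x ^ 3 = x) :
    ∃ r : ZMod 3, x = algebraMap (ZMod 3) GF729 r := by
  have h' : x * ((x - 1) * (x + 1)) = 0 := by linear_combination h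
  rcases mul_eq_zero.1 h' with h | h
  · exact ⟨0, by simp [h]⟩
  rcases mul_eq_zero.1 h with h | h
  · exact ⟨1, by rw [map_one]; linear_combination h⟩
  · exact ⟨-1, by rw [map_neg, map_one]; linear_combination h⟩

theorem exists_mul_eq_one {x : GF729} (hx : x ≠ 0) : ∃ y, x * y = 1 := by
  obtain ⟨m, hm, rfl⟩ := exists_eq_gen_pow hx
  refine ⟨gen ^ (728 - m), ?_⟩
  rw [← pow_add, show m + (728 - m) = 728 by omega, gen_pow_card]

/-- Scale to `1, b, c` and put `B = b³ - b`, `C = c³ - c`. A zero determinant reads `B C³ = C B³`,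
so `C / B` is fixed by cubing and is some `t` in the prime field. Then `c - t b` is fixed by cubing
too, a linear relation. -/
theorem det_mooreMatrix_ne_zero {v : Fin 3 → GF729} (hv : LinearIndependent (ZMod 3) v) :
    (mooreMatrix ![0, 1, 2] v).det ≠ 0 := by
  intro h
  have ha : v 0 ≠ 0 := hv.ne_zero 0
  obtain ⟨u, hu⟩ := exists_mul_eq_one ha
  have hb : v 1 = v 0 * (u * v 1) := by rw [← mul_assoc, hu, one_mul]
  have hc : v 2 = v 0 * (u * v 2) := by rw [← mul_assoc, hu, one_mul]
  generalize u * v 1 = b at hb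
  generalize u * v 2 = c at hc
  have hv' : v = ![v 0, v 0 * b, v 0 * c] := by
    funext i
    fin_cases i
    exacts [rfl, hb, hc]
  have hrel : ∀ r s t : ZMod 3, algebraMap _ GF729 r + s • b + t • c = 0 →
      r = 0 ∧ s = 0 ∧ t = 0 := fun r s t h => by
    have := Fintype.linearIndependent_iff.1 hv ![r, s, t] (by
      rw [Fin.sum_univ_three, hb, hc]
      change r • v 0 + s • (v 0 * b) + t • (v 0 * c) = 0
      simp only [Algebra.smul_def] at h ⊢
      linear_combination v 0 * h)
    exact ⟨this 0, this 1, this 2⟩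
  rw [hv', det_mooreMatrix_scaled] at h
  have h1 := (mul_eq_zero.1 h).resolve_left (pow_ne_zero _ ha)
  have hB : b ^ 3 - b ≠ 0 := fun hB => by
    obtain ⟨r, hr⟩ := exists_algebraMap_of_cube_eq (sub_eq_zero.1 hB)
    have := (hrel (-r) 1 0 (by rw [hr, map_neg, one_smul, zero_smul]; ring)).2.1
    exact one_ne_zero this
  obtain ⟨w, hw⟩ := exists_mul_eq_one hB
  have h2 : ((c ^ 3 - c) * w) ^ 3 = (c ^ 3 - c) * w := by
    have hB3 := sub_pow_char_pow (p := 3) (n := 1) (b ^ 3) b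
    have hC3 := sub_pow_char_pow (p := 3) (n := 1) (c ^ 3) c
    norm_num [← pow_mul] at hB3 hC3 h1
    rw [← hB3, ← hC3] at h1
    have hw3 : (b ^ 3 - b) ^ 3 * w ^ 3 = 1 := by rw [← mul_pow, hw, one_pow]
    rw [mul_pow]
    linear_combination w ^ 4 * h1 - w ^ 3 * (c ^ 3 - c) ^ 3 * hw + (c ^ 3 - c) * w * hw3
  obtain ⟨t, ht⟩ := exists_algebraMap_of_cube_eq h2
  have h3 : (c - t • b) ^ 3 = c - t • b := by
    have e1 := sub_pow_char_pow (p := 3) (n := 1) c (t • b)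
    have e2 := smul_pow_three_pow t b 1
    norm_num at e1 e2
    rw [e1, e2, Algebra.smul_def, Algebra.smul_def, ← ht]
    linear_combination - (c ^ 3 - c) * hw
  obtain ⟨r, hr⟩ := exists_algebraMap_of_cube_eq h3
  have := (hrel (-r) (-t) 1 (by rw [map_neg, ← hr, one_smul, neg_smul]; ring)).2.2
  exact one_ne_zero this

end GF729

/-! ### The finite verification -/

namespace NatSextuple

/-- The coordinates of `GF729.mooreMap b c`. -/
def mooreCoords (b c : NatSextuple) : NatSextuple × NatSextuple :=
  (sub (mul (sub (cube b) b) (sub (cube (cube c)) (cube c)))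
    (mul (sub (cube c) c) (sub (cube (cube b)) (cube b))),
   sub (mul (sub (cube b) b) (sub (cube (cube (cube c))) (cube c)))
    (mul (sub (cube c) c) (sub (cube (cube (cube b))) (cube b))))

def toPair (z : NatSextuple × NatSextuple) : GF729 × GF729 := (z.1.toGF, z.2.toGF)

theorem toPair_mooreCoords (b c : NatSextuple) :
    toPair (mooreCoords b c) = GF729.mooreMap b.toGF c.toGF := by
  simp only [toPair, mooreCoords, toGF_sub, toGF_mul, toGF_cube, GF729.mooreMap,
    LinearMap.coe_mk, AddHom.coe_mk, ← pow_mul]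

/-- The tree sum of the weights, calculated with coordinates. -/
def weightSum : List (NatSextuple × NatSextuple) → NatSextuple → NatSextuple → ℕ
  | [], x, y => GF729.weightOfCodes x.code y.code
  | w :: l, x, y => weightSum l x y + weightSum l (add x w.1) (add y w.2) +
      weightSum l (add (add x w.1) w.1) (add (add y w.2) w.2)

theorem weightSum_eq (l : List (NatSextuple × NatSextuple)) (x y : NatSextuple) :
    weightSum l x y =
      treeSum (fun z => GF729.weight z.1 z.2) (l.map toPair) (x.toGF, y.toGF) := by
  induction l generalizing x y with
  | nil => simp [weightSum, treeSum, GF729.weight, GF729.code_toGF]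
  | cons w l ih => simp [weightSum, treeSum, ih, toGF_add, toPair]

/-- Tests whether the weights add up to the number of summands. -/
def checkWeights (l : List NatSextuple) (b : NatSextuple) : Bool :=
  -- Four directions give `3 ^ 4 = 81` summands; since a weight is a sign plus one, the value 81
  -- means that the signs cancel.
  Nat.beq (weightSum (l.map (mooreCoords b)) ⟨0, 0, 0, 0, 0, 0⟩ ⟨0, 0, 0, 0, 0, 0⟩) 81

def allResidues (p : ℕ → Bool) : Bool := p 0 && p 1 && p 2

theorem allResidues_apply {p : ℕ → Bool} (h : allResidues p = true) (x : ZMod 3) :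
    p x.val = true := by
  simp only [allResidues, Bool.and_eq_true] at h
  have hx : x = 0 ∨ x = 1 ∨ x = 2 := by revert x; decide
  rcases hx with rfl | rfl | rfl
  exacts [h.1.1, h.1.2, h.2]

/-- The five checks treat `b` with zero constant coordinate and first nonzero coordinate 1. The
directions are the standard basis without 1 and without the leading vector of `b`, a complement of
the plane spanned by `1, b`. -/
theorem checkWeights_t : (allResidues fun a => allResidues fun b => allResidues fun c =>
    allResidues fun d => checkWeights [⟨0, 0, 1, 0, 0, 0⟩, ⟨0, 0, 0, 1, 0, 0⟩, ⟨0, 0, 0, 0, 1, 0⟩,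
      ⟨0, 0, 0, 0, 0, 1⟩] ⟨0, 1, a, b, c, d⟩) = true := by decide +kernel

theorem checkWeights_t_sq : (allResidues fun b => allResidues fun c => allResidues fun d =>
    checkWeights [⟨0, 1, 0, 0, 0, 0⟩, ⟨0, 0, 0, 1, 0, 0⟩, ⟨0, 0, 0, 0, 1, 0⟩,
      ⟨0, 0, 0, 0, 0, 1⟩] ⟨0, 0, 1, b, c, d⟩) = true := by decide +kernel

theorem checkWeights_i : (allResidues fun c => allResidues fun d =>
    checkWeights [⟨0, 1, 0, 0, 0, 0⟩, ⟨0, 0, 1, 0, 0, 0⟩, ⟨0, 0, 0, 0, 1, 0⟩,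
      ⟨0, 0, 0, 0, 0, 1⟩] ⟨0, 0, 0, 1, c, d⟩) = true := by decide +kernel

theorem checkWeights_it : (allResidues fun d =>
    checkWeights [⟨0, 1, 0, 0, 0, 0⟩, ⟨0, 0, 1, 0, 0, 0⟩, ⟨0, 0, 0, 1, 0, 0⟩,
      ⟨0, 0, 0, 0, 0, 1⟩] ⟨0, 0, 0, 0, 1, d⟩) = true := by decide +kernel

theorem checkWeights_it_sq :
    checkWeights [⟨0, 1, 0, 0, 0, 0⟩, ⟨0, 0, 1, 0, 0, 0⟩, ⟨0, 0, 0, 1, 0, 0⟩,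
      ⟨0, 0, 0, 0, 1, 0⟩] ⟨0, 0, 0, 0, 0, 1⟩ = true := by decide +kernel

end NatSextuple

/-! ### Cancellation over every plane of the field -/

namespace GF729

theorem mooreMap_self (b : GF729) : mooreMap b b = 0 := by
  ext <;> simp only [mooreMap, LinearMap.coe_mk, AddHom.coe_mk, Prod.fst_zero, Prod.snd_zero] <;>
    ring

theorem mooreMap_one (b : GF729) : mooreMap b 1 = 0 := by
  refine Prod.ext ?_ ?_
  · show (b ^ 3 - b) * (1 ^ 9 - 1 ^ 3) - (1 ^ 3 - 1) * (b ^ 9 - b ^ 3) = 0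
    ring
  · show (b ^ 3 - b) * (1 ^ 27 - 1 ^ 3) - (1 ^ 3 - 1) * (b ^ 27 - b ^ 3) = 0
    ring

theorem mooreMap_neg_neg (b c : GF729) : mooreMap (-b) (-c) = mooreMap b c := by
  refine Prod.ext ?_ ?_
  · show ((-b) ^ 3 - -b) * ((-c) ^ 9 - (-c) ^ 3) - ((-c) ^ 3 - -c) * ((-b) ^ 9 - (-b) ^ 3) =
      (b ^ 3 - b) * (c ^ 9 - c ^ 3) - (c ^ 3 - c) * (b ^ 9 - b ^ 3)
    ring
  · show ((-b) ^ 3 - -b) * ((-c) ^ 27 - (-c) ^ 3) - ((-c) ^ 3 - -c) * ((-b) ^ 27 - (-b) ^ 3) =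
      (b ^ 3 - b) * (c ^ 27 - c ^ 3) - (c ^ 3 - c) * (b ^ 27 - b ^ 3)
    ring

theorem mooreMap_add_algebraMap (b : GF729) (r : ZMod 3) :
    mooreMap (b + algebraMap (ZMod 3) GF729 r) = mooreMap b := by
  have h : ∀ k, (b + algebraMap (ZMod 3) GF729 r) ^ 3 ^ k =
      b ^ 3 ^ k + algebraMap (ZMod 3) GF729 r := fun k => by
    rw [add_pow_char_pow, ← map_pow, ZMod.pow_card_pow]
  have h1 := h 1
  have h2 := h 2
  have h3 := h 3
  norm_num at h1 h2 h3
  refine LinearMap.ext fun c => ?_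
  generalize algebraMap (ZMod 3) GF729 r = s at h1 h2 h3
  refine Prod.ext ?_ ?_
  · show ((b + s) ^ 3 - (b + s)) * (c ^ 9 - c ^ 3) - (c ^ 3 - c) * ((b + s) ^ 9 - (b + s) ^ 3) =
      (b ^ 3 - b) * (c ^ 9 - c ^ 3) - (c ^ 3 - c) * (b ^ 9 - b ^ 3)
    rw [h1, h2]
    ring
  · show ((b + s) ^ 3 - (b + s)) * (c ^ 27 - c ^ 3) - (c ^ 3 - c) * ((b + s) ^ 27 - (b + s) ^ 3) =
      (b ^ 3 - b) * (c ^ 27 - c ^ 3) - (c ^ 3 - c) * (b ^ 27 - b ^ 3)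
    rw [h1, h3]
    ring

/-- The total weight of the triples `1, b, c`. -/
def totalWeight (b : GF729) : ℕ := ∑ c : GF729, weight (mooreMap b c).1 (mooreMap b c).2

/-- Each of the two zero directions, `0` and `k`, contributes a factor 3. -/
theorem treeSum_ofFn_ite {W : Type} [AddCommGroup W] (G : W → ℕ) (w : Fin 6 → W) (hw : w 0 = 0)
    {k : Fin 6} (hk : k ≠ 0) (x : W) :
    treeSum G (List.ofFn fun i => if i = k then 0 else w i) x =
      9 * treeSum G ((List.ofFn w).tail.eraseIdx (k.val - 1)) x := by
  have key : ∀ l l' : List W, treeSum G (0 :: (l ++ 0 :: l')) x = 9 * treeSum G (l ++ l') x :=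
    fun l l' => by
      rw [← List.nil_append (0 :: _), treeSum_append_zero_cons, List.nil_append,
        treeSum_append_zero_cons]
      ring
  fin_cases k
  · exact absurd rfl hk
  · simpa [List.ofFn_succ, hw] using key [] [w 2, w 3, w 4, w 5]
  · simpa [List.ofFn_succ, hw] using key [w 1] [w 3, w 4, w 5]
  · simpa [List.ofFn_succ, hw] using key [w 1, w 2] [w 4, w 5]
  · simpa [List.ofFn_succ, hw] using key [w 1, w 2, w 3] [w 5]
  · simpa [List.ofFn_succ, hw] using key [w 1, w 2, w 3, w 4] []

/-- The standard basis of `GF729` in coordinates. -/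
def stdBasis : Fin 6 → NatSextuple :=
  ![⟨1, 0, 0, 0, 0, 0⟩, ⟨0, 1, 0, 0, 0, 0⟩, ⟨0, 0, 1, 0, 0, 0⟩, ⟨0, 0, 0, 1, 0, 0⟩,
    ⟨0, 0, 0, 0, 1, 0⟩, ⟨0, 0, 0, 0, 0, 1⟩]

theorem single_eq_toGF :
    ∀ i : Fin 6, (Pi.single i 1 : Fin 6 → ZMod 3) = (stdBasis i).toGF := by
  intro i
  funext j
  fin_cases i <;> fin_cases j <;> rfl

theorem totalWeight_eq {k : Fin 6} (hk : k ≠ 0) (x : NatSextuple) (hx : x.toGF k = 1)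
    (h : NatSextuple.checkWeights ((List.ofFn stdBasis).tail.eraseIdx (k.val - 1)) x = true) :
    totalWeight x.toGF = 729 := by
  have h1 := sum_eq_treeSum_update (W := GF729 × GF729) (fun z => weight z.1 z.2) (n := 6)
    (mooreMap x.toGF) (b := x.toGF) (k := k) hx (mooreMap_self _)
  have h2 := Nat.eq_of_beq_eq_true h
  let w : Fin 6 → GF729 × GF729 := fun i => mooreMap x.toGF (stdBasis i).toGF
  have h3 : totalWeight x.toGF = treeSum (fun z => weight z.1 z.2)
      (List.ofFn fun i => if i = k then 0 else w i) 0 :=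
    h1.trans (congrArg (fun l => treeSum _ (List.ofFn l) 0)
      (funext fun i => if_congr Iff.rfl rfl (congrArg (mooreMap x.toGF) (single_eq_toGF i))))
  have hw : w 0 = 0 := by
    show mooreMap x.toGF (NatSextuple.toGF ⟨1, 0, 0, 0, 0, 0⟩) = 0
    rw [NatSextuple.toGF_one, mooreMap_one]
  have e : (NatSextuple.toPair ∘ NatSextuple.mooreCoords x) ∘ stdBasis = w :=
    funext fun i => NatSextuple.toPair_mooreCoords _ _
  rw [NatSextuple.weightSum_eq, NatSextuple.toGF_zero, List.map_map, ← List.eraseIdx_map,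
    List.map_tail, List.map_ofFn, e] at h2
  rw [h3, treeSum_ofFn_ite _ w hw hk]
  exact congrArg (9 * ·) h2

theorem totalWeight_neg (b : GF729) : totalWeight (-b) = totalWeight b := by
  rw [totalWeight, ← Equiv.sum_comp (Equiv.neg GF729)]
  simp only [Equiv.neg_apply, mooreMap_neg_neg]
  rfl

/-- Negating `b` if necessary makes its leading coordinate 1; the position of that coordinate
selects the check. -/
theorem totalWeight_of_lead {b : GF729} {k : Fin 6} (hk : k ≠ 0) (h : ∀ j < k, b j = 0)
    (hb : b k ≠ 0) : totalWeight b = 729 := by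
  wlog h1 : b k = 1 generalizing b
  · rw [← totalWeight_neg]
    have hneg : ∀ j, (-b) j = - b j := fun _ => rfl
    have e : ∀ y : ZMod 3, y ≠ 0 → y ≠ 1 → -y = 1 := by decide
    refine this (fun j hj => ?_) ?_ ?_
    · rw [hneg, h j hj, neg_zero]
    · rw [hneg]
      exact neg_ne_zero.2 hb
    · rw [hneg]
      exact e _ hb h1
  let x : NatSextuple :=
    ⟨(b 0).val, (b 1).val, (b 2).val, (b 3).val, (b 4).val, (b 5).val⟩
  have hx : b = x.toGF := by
    funext j
    fin_cases j <;> simp [x, NatSextuple.toGF]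
  rw [hx]
  refine totalWeight_eq hk x (hx ▸ h1) ?_
  fin_cases k
  · exact absurd rfl hk
  · have h0 := h 0 (by decide)
    have h1 : b 1 = 1 := h1
    simp only [x, h0, h1]
    exact NatSextuple.allResidues_apply (NatSextuple.allResidues_apply
      (NatSextuple.allResidues_apply (NatSextuple.allResidues_apply
        NatSextuple.checkWeights_t (b 2)) (b 3)) (b 4)) (b 5)
  · have h0 := h 0 (by decide)
    have h1' := h 1 (by decide)
    have h1 : b 2 = 1 := h1
    simp only [x, h0, h1, h1']
    exact NatSextuple.allResidues_apply (NatSextuple.allResidues_apply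
      (NatSextuple.allResidues_apply NatSextuple.checkWeights_t_sq (b 3)) (b 4)) (b 5)
  · have h0 := h 0 (by decide)
    have h1' := h 1 (by decide)
    have h2 := h 2 (by decide)
    have h1 : b 3 = 1 := h1
    simp only [x, h0, h1, h1', h2]
    exact NatSextuple.allResidues_apply (NatSextuple.allResidues_apply
      NatSextuple.checkWeights_i (b 4)) (b 5)
  · have h0 := h 0 (by decide)
    have h1' := h 1 (by decide)
    have h2 := h 2 (by decide)
    have h3 := h 3 (by decide)
    have h1 : b 4 = 1 := h1
    simp only [x, h0, h1, h1', h2, h3]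
    exact NatSextuple.allResidues_apply NatSextuple.checkWeights_it (b 5)
  · have h0 := h 0 (by decide)
    have h1' := h 1 (by decide)
    have h2 := h 2 (by decide)
    have h3 := h 3 (by decide)
    have h4 := h 4 (by decide)
    have h1 : b 5 = 1 := h1
    simp only [x, h0, h1, h1', h2, h3, h4]
    exact NatSextuple.checkWeights_it_sq

theorem totalWeight_of_ne {b : GF729} (hb : ∀ r, b ≠ algebraMap (ZMod 3) GF729 r) :
    totalWeight b = 729 := by
  classical
  have hone : ∀ r : ZMod 3, algebraMap (ZMod 3) GF729 r =
      r • (![1, 0, 0, 0, 0, 0] : Fin 6 → ZMod 3) := fun r => Algebra.algebraMap_eq_smul_one r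
  set d : GF729 := b + algebraMap (ZMod 3) GF729 (-(b 0)) with hd
  have hd0 : d 0 = 0 := by
    show b 0 + (algebraMap (ZMod 3) GF729 (-(b 0))) 0 = 0
    rw [hone]
    simp
  have hne : ∃ j : Fin 6, d j ≠ 0 := by
    by_contra! h
    have h0 : d = 0 := funext h
    rw [hd, map_neg, ← sub_eq_add_neg, sub_eq_zero] at h0
    exact hb _ h0
  have e : totalWeight b = totalWeight d := by
    rw [totalWeight, totalWeight, hd, mooreMap_add_algebraMap]
  rw [e]
  let k := Fin.find (fun j : Fin 6 => d j ≠ 0) hne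
  have hk : d k ≠ 0 := Fin.find_spec hne
  refine totalWeight_of_lead (k := k) (fun h => hk (h ▸ hd0)) (fun j hj => ?_) hk
  by_contra h
  exact Fin.find_min hne hj h

theorem sum_sgn_mooreMap {b : GF729} (hb : ∀ r, b ≠ algebraMap (ZMod 3) GF729 r) :
    ∑ c : GF729, sgn (mooreMap b c).1 (mooreMap b c).2 = 0 := by
  have h := totalWeight_of_ne hb
  simp only [sgn, Finset.sum_sub_distrib]
  rw [← Nat.cast_sum, show ∑ c : GF729, weight (mooreMap b c).1 (mooreMap b c).2 = 729 from h]
  simp [card_eq]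

/-- The transition matrix is invertible because the Moore determinant of `v'` is nonzero, so the
sign depends only on the span. -/
theorem tripleSgn_eq_of_span_eq {v v' : Fin 3 → GF729} (hv' : LinearIndependent (ZMod 3) v')
    (h : span (ZMod 3) (Set.range v') ≤ span (ZMod 3) (Set.range v)) :
    tripleSgn v' = tripleSgn v := by
  have hA : ∀ i, ∃ a : Fin 3 → ZMod 3, ∑ j, a j • v j = v' i := fun i =>
    (mem_span_range_iff_exists_fun (ZMod 3)).1 (h (subset_span ⟨i, rfl⟩))
  choose A hA using hA
  have e : v' = fun i => ∑ j, (Matrix.of A) i j • v j := funext fun i => (hA i).symm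
  have hd : (Matrix.of A).det ≠ 0 := fun h0 => by
    refine det_mooreMatrix_ne_zero hv' ?_
    rw [e, det_mooreMatrix_sum_smul, h0, zero_smul]
  rw [e, tripleSgn_sum_smul, if_neg hd]

/-- Applying Frobenius powers to a linear relation turns it into a relation among the rows of the
Moore matrix. -/
theorem tripleSgn_eq_zero {v : Fin 3 → GF729} (hv : ¬ LinearIndependent (ZMod 3) v) :
    tripleSgn v = 0 := by
  obtain ⟨g, hg, i, hi⟩ := Fintype.not_linearIndependent_iff.1 hv
  have h : (mooreMatrix ![0, 1, 2] v).det = 0 := by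
    refine Matrix.exists_vecMul_eq_zero_iff.1
      ⟨fun j => algebraMap (ZMod 3) GF729 (g j), fun h => hi ?_, funext fun j => ?_⟩
    · exact (map_eq_zero_iff _ (algebraMap (ZMod 3) GF729).injective).1 (congrFun h i)
    · have h := congrArg (· ^ 3 ^ (![0, 1, 2] : Fin 3 → ℕ) j) hg
      simp only [sum_pow_char_pow, smul_pow_three_pow] at h
      rw [zero_pow (pow_ne_zero _ (by norm_num))] at h
      simp only [Algebra.smul_def] at h
      exact h
  rw [tripleSgn, h, sgn_zero]

open Classical in
/-- The sign of the span of three independent field elements. -/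
noncomputable def subspaceSgn (U : Submodule (ZMod 3) GF729) : ℤ :=
  if ∃ v : Fin 3 → GF729, LinearIndependent (ZMod 3) v ∧ span (ZMod 3) (Set.range v) = U ∧
    tripleSgn v = -1 then -1 else 1

theorem subspaceSgn_span {v : Fin 3 → GF729} (hv : LinearIndependent (ZMod 3) v) :
    subspaceSgn (span (ZMod 3) (Set.range v)) = tripleSgn v := by
  have hs : tripleSgn v = 1 ∨ tripleSgn v = -1 := sgn_eq (det_mooreMatrix_ne_zero hv) _
  rw [subspaceSgn]
  split_ifs with h
  · obtain ⟨v', hv', h1, h2⟩ := h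
    rw [← h2, tripleSgn_eq_of_span_eq hv' h1.le]
  · refine (hs.resolve_right fun h' => h ⟨v, hv, rfl, h'⟩).symm

theorem isHalving_subspaceSgn : IsHalving (ZMod 3) 2 subspaceSgn where
  sign U := by
    rw [subspaceSgn]
    split_ifs <;> simp
  sum_eq_zero T hT := by
    classical
    let w := finBasisOfFinrankEq (ZMod 3) T hT
    have hw : span (ZMod 3) (Set.range fun i => (w i : GF729)) = T := by
      have h := congrArg (map T.subtype) w.span_eq
      rw [map_span, ← Set.range_comp, Submodule.map_top, range_subtype] at h
      exact h
    have hli : LinearIndependent (ZMod 3) fun i => (w i : GF729) :=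
      w.linearIndependent.map' T.subtype T.ker_subtype
    set a : GF729 := (w 0).1
    set b : GF729 := (w 1).1
    have hab : (fun i => (w i : GF729)) = ![a, b] := by
      funext i
      fin_cases i <;> rfl
    rw [hab] at hw hli
    have ha : a ≠ 0 := hli.ne_zero 0
    obtain ⟨u, hu⟩ := exists_mul_eq_one ha
    have hβ : ∀ r, u * b ≠ algebraMap (ZMod 3) GF729 r := fun r hr => by
      have h1 : b = r • a := by
        rw [Algebra.smul_def, ← hr, mul_right_comm, mul_comm u, hu, one_mul]
      have := LinearIndependent.pair_iff.1 hli r (-1) (by rw [h1]; simp)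
      exact absurd this.2 (by decide)
    obtain ⟨ε, hε⟩ := tripleSgn_scaled ha
    have key : ∀ c, (if c ∈ T then 0 else subspaceSgn (T ⊔ span (ZMod 3) {c})) =
        tripleSgn ![a, b, c] := fun c => by
      have hr : T ⊔ span (ZMod 3) {c} = span (ZMod 3) (Set.range ![a, b, c]) := by
        rw [← hw, ← span_union]
        congr 1
        ext y
        simp only [Matrix.range_cons, Matrix.range_empty, Set.union_empty, Set.mem_union]
        tauto
      split_ifs with hc
      · refine (tripleSgn_eq_zero fun h => ?_).symm
        have h3 := finrank_span_eq_card h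
        rw [← hr, sup_eq_left.2 ((span_singleton_le_iff_mem c T).2 hc), hT] at h3
        simp at h3
      · rw [hr, subspaceSgn_span]
        rw [linearIndependent_iff_card_eq_finrank_span, Set.finrank, ← hr,
          finrank_sup_span_singleton hc, hT]
        simp
    rw [finsum_congr key, finsum_eq_sum_of_fintype]
    -- Substituting `a * c` for `c` brings the triple into the scaled form `a, a * β, a * c`.
    have hmul : Function.Bijective fun c : GF729 => a * c :=
      Finite.injective_iff_bijective.1 fun c c' h => mul_left_cancel₀ ha h
    rw [← hmul.sum_comp]
    have hb : b = a * (u * b) := by rw [← mul_assoc, hu, one_mul]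
    have h0 := sum_sgn_mooreMap hβ
    generalize u * b = β at hb h0
    simp only [hb, hε, ← Finset.mul_sum, h0, mul_zero]

theorem hasHalvings : HasHalvings (ZMod 3) 2 6 := by
  classical
  intro V _ _ _ hV
  have : Finite V := Module.finite_of_finite (ZMod 3)
  let e : V ≃ₗ[ZMod 3] GF729 := LinearEquiv.ofFinrankEq V GF729 (hV.trans finrank_eq.symm)
  refine ⟨fun U => subspaceSgn (U.map e.toLinearMap), fun U => isHalving_subspaceSgn.sign _,
    fun T hT => ?_⟩
  have h := isHalving_subspaceSgn.sum_eq_zero (T.map e.toLinearMap)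
    ((LinearEquiv.finrank_map_eq e T).trans hT)
  rw [← finsum_comp_equiv e.toEquiv] at h
  refine Eq.trans (finsum_congr fun c => ?_) h
  have hc : e.toEquiv c ∈ T.map e.toLinearMap ↔ c ∈ T := by
    simp
  rw [Submodule.map_sup, map_span, Set.image_singleton]
  simp only [hc]
  rfl

end GF729

theorem corollary5p6 :
    {p : ℕ × ℕ × ℕ × ℕ | ∃ q N k v : ℕ, p = (q, N, k, v) ∧ 2 ≤ N ∧ 2 ≤ k ∧ k ≤ v ∧
      LargeSetRealizable q N 2 k v}.Infinite :=
  GF729.hasHalvings.infinite_largeSetRealizable
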